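/- For a bounded domain $\Omega\subset\mathbb{R}^k$ let $\mathscr{N}^{\mathtt N}_\Omega(\mu)$ ($\mu\ge 0$) be the number, counted with multiplicity, of eigenvalues $\lambda$ of the Neumann Laplacian $-\Delta$ on $\Omega$ with $\sqrt{\lambda}\le\mu$; here $\lambda$ is an eigenvalue with eigenfunction $0\neq u\in H^1(\Omega)$ if $\int_\Omega\nabla u\cdot\nabla w=\lambda\int_\Omega u\,w$ for all $w\in H^1(\Omega)$. Let $\omega_k$ be the volume of the unit ball of $\mathbb{R}^k$. We say that the Neumann Pólya conjecture holds for $\Omega$ if $\mathscr{N}^{\mathtt N}_\Omega(\mu)\ge\frac{\omega_k}{(2\pi)^k}|\Omega|\mu^k$ for all $\mu\ge 0$. **Theorem.** Let $d\ge 3$, let $\mathscr{D}\subset\mathbb{R}^{d-1}$ be a bounded domain, $I\subset\mathbb{R}$ an interval of length $L\in(0,\infty)$, and $\mathcal{C}_d=\mathscr{D}\times I\subset\mathbb{R}^d$. If $I$ is not open, the Neumann Laplacian on $\mathcal{C}_d$ is that of the interior of $\mathcal{C}_d$. Suppose that the Neumann Pólya conjecture holds for $\mathscr{D}$. Then, for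 $\mu\ge 0$: (a) If $d=3$, $$\mathscr{N}^{\mathtt N}_{\mathcal{C}_3}(\mu)-\frac{\omega_3}{(2\pi)^3}|\mathcal{C}_3|\mu^3\ \ge\ \begin{cases}\dfrac{|\mathcal{C}_3|}{8L^2}\left(\dfrac{L\mu}{\pi}-\dfrac13\right)\mu, & \text{if } \dfrac{L\mu}{\pi}\ge\dfrac13,\\[2mm] \dfrac{|\mathcal{C}_3|}{6\pi L}\left(\dfrac32-\dfrac{L\mu}{\pi}\right)\mu^2, & \text{if } 0\le\dfrac{L\mu}{\pi}\le\dfrac32,\end{cases}$$ both bounds being valid where the two ranges overlap. (b) If $d\ge 4$ and $0\le\frac{L\mu}{\pi}\le\frac{2\Gamma(\frac{d+2}{2})}{\sqrt\pi\,\Gamma(\frac{d+1}{2})}$, $$\mathscr{N}^{\mathtt N}_{\mathcal{C}_d}(\mu)\ \ge\ \frac{\omega_d}{(2\pi)^d}|\mathcal{C}_d|\mu^d+\frac{\omega_d|\mathcal{C}_d|}{2(2\pi)^{d-1}L}\left(\frac{2\Gamma(\frac{d+2}{2})}{\sqrt\pi\,\Gamma(\frac{d+1}{2})}-\frac{L\mu}{\pi}\right)\mu^{d-1}.$$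 (c) If $d\ge 4$ and $\mu\ge\pi\sqrt{d-2}/L$, then with $$T=\frac{\left\lfloor\frac{L\mu}{\pi\sqrt{d-2}}\right\rfloor-1}{L\mu/\pi},\qquad A_1=\begin{cases}\frac{d-3}{4}, & d\ge 5,\\ \frac23, & d=4,\end{cases}$$ $$\mathscr{N}^{\mathtt N}_{\mathcal{C}_d}(\mu)\ \ge\ \frac{\omega_d}{(2\pi)^d}|\mathcal{C}_d|\mu^d+\frac{(d-1)\omega_{d-1}|\mathcal{C}_d|}{4(2\pi)^{d-1}L}\,T^2\left(1-A_1T^2\right)\mu^{d-1}.$$ (d) If $d\ge 11$ and $\mu\ge\pi\sqrt{d-2}/L$, the inequality in (c) still holds when $$\frac{\omega_{d-1}|\mathcal{C}_d|}{2(2\pi)^{d-1}L}\left(1-\left(\frac{\pi}{L\mu}\left(\left\lfloor\frac{L\mu}{\pi\sqrt{d-2}}\right\rfloor+1\right)\right)^2\right)^{\frac{d-1}{2}}\mu^{d-1}$$ is added to its right-hand side. (e) In particular, the Neumann Pólya conjecture holds for $\mathcal{C}_d=\mathscr{D}\times I$. -/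

import Mathlib

open MeasureTheory
open scoped ENNReal

noncomputable section

/-- The Sobolev space `H¹(Ω)`: pairs `(u, g)` with `u ∈ L²(Ω)` and `g ∈ L²(Ω; ℝᵏ)` such that `g` is
the weak gradient of `u` in the interior of `Ω` (which is `Ω` itself when `Ω` is open). -/
def sobolevH1 {k : ℕ} (Ω : Set (EuclideanSpace ℝ (Fin k))) :
    Submodule ℝ (Lp ℝ 2 (volume.restrict Ω) ×
      Lp (EuclideanSpace ℝ (Fin k)) 2 (volume.restrict Ω)) where
  carrier := {p | ∀ φ : EuclideanSpace ℝ (Fin k) → ℝ, ContDiff ℝ (⊤ : ℕ∞) φ →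
    HasCompactSupport φ → tsupport φ ⊆ interior Ω → ∀ v : EuclideanSpace ℝ (Fin k),
      ∫ x in Ω, p.1 x * fderiv ℝ φ x v = - ∫ x in Ω, inner ℝ (p.2 x) v * φ x}
  zero_mem' := by
    intro φ _ _ _ v
    have h1 : ∫ x in Ω, ((0 : Lp ℝ 2 (volume.restrict Ω)) : _ → ℝ) x * fderiv ℝ φ x v = 0 := by
      rw [← integral_zero (EuclideanSpace ℝ (Fin k)) ℝ (μ := volume.restrict Ω)]
      apply integral_congr_ae
      filter_upwards [Lp.coeFn_zero ℝ 2 (volume.restrict Ω)] with x hx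
      rw [hx, Pi.zero_apply]
      simp
    have h2 : ∫ x in Ω, inner ℝ (((0 : Lp (EuclideanSpace ℝ (Fin k)) 2 (volume.restrict Ω)) :
        _ → EuclideanSpace ℝ (Fin k)) x) v * φ x = 0 := by
      rw [← integral_zero (EuclideanSpace ℝ (Fin k)) ℝ (μ := volume.restrict Ω)]
      apply integral_congr_ae
      filter_upwards [Lp.coeFn_zero (EuclideanSpace ℝ (Fin k)) 2 (volume.restrict Ω)] with x hx
      rw [hx, Pi.zero_apply]
      simp
    simp only [Prod.fst_zero, Prod.snd_zero]
    rw [h1, h2, neg_zero]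
  add_mem' := by
    rintro ⟨u, g⟩ ⟨u', g'⟩ h h' φ hφ hc hs v
    have hφ2 : MemLp φ 2 (volume.restrict Ω) :=
      (hφ.continuous.memLp_of_hasCompactSupport hc).restrict Ω
    have hd2 : MemLp (fun x => fderiv ℝ φ x v) 2 (volume.restrict Ω) :=
      (((hφ.continuous_fderiv (by simp)).clm_apply continuous_const).memLp_of_hasCompactSupport
        (hc.fderiv_apply ℝ v)).restrict Ω
    have iu : ∀ w : Lp ℝ 2 (volume.restrict Ω),
        Integrable (fun x => w x * fderiv ℝ φ x v) (volume.restrict Ω) :=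
      fun w => (Lp.memLp w).integrable_mul hd2
    have ig : ∀ w : Lp (EuclideanSpace ℝ (Fin k)) 2 (volume.restrict Ω),
        Integrable (fun x => inner ℝ (w x) v * φ x) (volume.restrict Ω) :=
      fun w => ((Lp.memLp w).inner_const v).integrable_mul hφ2
    have e := h φ hφ hc hs v
    have e' := h' φ hφ hc hs v
    have h1 : ∫ x in Ω, (u + u') x * fderiv ℝ φ x v =
        ∫ x in Ω, (u x * fderiv ℝ φ x v + u' x * fderiv ℝ φ x v) := by
      apply integral_congr_ae
      filter_upwards [Lp.coeFn_add u u'] with x hx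
      simp only [hx, Pi.add_apply, add_mul]
    have h2 : ∫ x in Ω, inner ℝ ((g + g') x) v * φ x =
        ∫ x in Ω, (inner ℝ (g x) v * φ x + inner ℝ (g' x) v * φ x) := by
      apply integral_congr_ae
      filter_upwards [Lp.coeFn_add g g'] with x hx
      simp only [hx, Pi.add_apply, inner_add_left, add_mul]
    simp only [Prod.mk_add_mk]
    rw [h1, h2, integral_add (iu u) (iu u'), integral_add (ig g) (ig g')]
    simp only at e e'
    rw [e, e']
    ring
  smul_mem' := by
    rintro c ⟨u, g⟩ h φ hφ hc hs v
    have e := h φ hφ hc hs v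
    have h1 : ∫ x in Ω, (c • u) x * fderiv ℝ φ x v =
        ∫ x in Ω, c * (u x * fderiv ℝ φ x v) := by
      apply integral_congr_ae
      filter_upwards [Lp.coeFn_smul c u] with x hx
      simp only [hx, Pi.smul_apply, smul_eq_mul, mul_assoc]
    have h2 : ∫ x in Ω, inner ℝ ((c • g) x) v * φ x =
        ∫ x in Ω, c * (inner ℝ (g x) v * φ x) := by
      apply integral_congr_ae
      filter_upwards [Lp.coeFn_smul c g] with x hx
      simp only [hx, Pi.smul_apply, real_inner_smul_left, mul_assoc]
    simp only [Prod.smul_mk]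
    rw [h1, h2, integral_const_mul, integral_const_mul]
    simp only at e
    rw [e]
    ring

/-- The eigenspace of the Neumann Laplacian `-Δ` on `Ω` for the number `ν`: all `u ∈ H¹(Ω)`
(recorded together with their gradients) such that `∫_Ω ∇u·∇w = ν ∫_Ω u w` for all `w ∈ H¹(Ω)`.
It is nonzero exactly when `ν` is a Neumann eigenvalue. -/
def neumannEigenspace {k : ℕ} (Ω : Set (EuclideanSpace ℝ (Fin k))) (ν : ℝ) :
    Submodule ℝ (Lp ℝ 2 (volume.restrict Ω) ×
      Lp (EuclideanSpace ℝ (Fin k)) 2 (volume.restrict Ω)) where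
  carrier := {p | p ∈ sobolevH1 Ω ∧
    ∀ q ∈ sobolevH1 Ω, inner ℝ p.2 q.2 = ν * inner ℝ p.1 q.1}
  zero_mem' := ⟨Submodule.zero_mem _, fun q _ => by simp⟩
  add_mem' := by
    rintro p p' ⟨hp, h⟩ ⟨hp', h'⟩
    refine ⟨Submodule.add_mem _ hp hp', fun q hq => ?_⟩
    rw [Prod.fst_add, Prod.snd_add, inner_add_left, inner_add_left, h q hq, h' q hq]
    ring
  smul_mem' := by
    rintro c p ⟨hp, h⟩
    refine ⟨Submodule.smul_mem _ c hp, fun q hq => ?_⟩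
    rw [Prod.smul_fst, Prod.smul_snd, real_inner_smul_left, real_inner_smul_left, h q hq]
    ring

/-- The Neumann counting function `𝒩_Ω(μ)`, for `μ ≥ 0`: the number of Neumann eigenvalues `ν`
with `√ν ≤ μ`, i.e. `ν ≤ μ²`, counted with multiplicity (negative `ν` have zero eigenspace). The
value `∞` can only occur for an `Ω` whose Neumann spectrum is not discrete. -/
def neumannCounting {k : ℕ} (Ω : Set (EuclideanSpace ℝ (Fin k))) (μ : ℝ) : ℝ≥0∞ :=
  ∑' ν : {ν : ℝ // ν ≤ μ ^ 2}, ((Module.rank ℝ (neumannEigenspace Ω ν)).toENat : ℝ≥0∞)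

/-- The volume `ω_k` of the unit ball in `ℝᵏ`. -/
def unitBallVol (k : ℕ) : ℝ :=
  volume.real (Metric.ball (0 : EuclideanSpace ℝ (Fin k)) 1)

/-- The Neumann Pólya conjecture for `Ω ⊆ ℝᵏ`: `ω_k/(2π)ᵏ |Ω| μᵏ ≤ 𝒩_Ω(μ)` for all `μ ≥ 0`. -/
def NeumannPolya {k : ℕ} (Ω : Set (EuclideanSpace ℝ (Fin k))) : Prop :=
  ∀ μ : ℝ, 0 ≤ μ →
    ENNReal.ofReal (unitBallVol k / (2 * Real.pi) ^ k * volume.real Ω * μ ^ k) ≤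
      neumannCounting Ω μ

/-- The product `D × I ⊆ ℝⁿ × ℝ = ℝⁿ⁺¹`. -/
def productDomain {n : ℕ} (D : Set (EuclideanSpace ℝ (Fin n))) (I : Set ℝ) :
    Set (EuclideanSpace ℝ (Fin (n + 1))) :=
  {x | WithLp.toLp 2 (fun i : Fin n => x i.castSucc) ∈ D ∧ x (Fin.last n) ∈ I}

/-- The constant `A₁` (used for `d ≥ 4` only). -/
def constA1 (d : ℕ) : ℝ := if 5 ≤ d then ((d : ℝ) - 3) / 4 else 2 / 3

/-- The quantity `(⌊Lμ / (π√(d-2))⌋ - 1) / (Lμ/π)`. -/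
def ratioT (d : ℕ) (L μ : ℝ) : ℝ :=
  ((⌊L * μ / (Real.pi * √((d : ℝ) - 2))⌋ : ℝ) - 1) / (L * μ / Real.pi)

end

/-! Write n = d - 1 and M = Lμ/π. If u is a Neumann eigenfunction of D with eigenvalue ν, then u(y)
cos(jπ(t - a)/L) is one of D × I with eigenvalue ν + (jπ/L)². Hence the counting function of D × I
at μ is at least the sum over 0 ≤ j ≤ M of that of D at √(μ² - (jπ/L)²) (`sum_neumannCounting_le`).
Only this inequality is used, so the completeness of the cosines plays no role. The Pólya bound on D
turns the sum into ω_n (2π)^(-n) |D| μⁿ Σ f(j/M) with f(x) = (1 - x²)^{n/2}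
(`neumannCounting_productDomain_ge`).

Slicing the unit ball gives ω_{n+1} = 2 ω_n ∫₀¹ f, so the Weyl term of D × I is the same prefactor
times M ∫₀¹ f (`weyl_term_eq`). Every claim thus becomes a lower bound for a left Riemann sum of a
decreasing function. Monotonicity alone gives (e). Keeping only the term j = 0 gives the bounds for
small μ. For n = 2 the sum is explicit (`sum_ballProfile_two_ge`). For n ≥ 3, f is concave up to
1/√(n - 1) and convex afterwards; comparison with secants on each side makes the cell errors
telescope (`sum_ballProfile_ge_improved`), and a second-order estimate of f at 0 yields (c) and (d).

The analytic difficulty is the weak eigenvalue equation against every w in H¹(D × I), without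
boundary regularity of D. The part of the gradient along D is handled by averaging w against the
cosine along the fibres, which lands in H¹(D). The part along I needs an integration by parts whose
boundary terms vanish because the sine vanishes at both ends of I. Both rest on one cutoff argument,
`integral_tensor_test_of_bound`. -/

open scoped BoundedContinuousFunction

/-! ### The profile (1 - x²)^{n/2}: convexity and behaviour at 0 -/

/-- The function `x ↦ (1 - x²)₊^{n/2}`. -/
noncomputable def ballProfile (n : ℕ) (x : ℝ) : ℝ := √(1 - x ^ 2) ^ n

lemma continuous_ballProfile (n : ℕ) : Continuous (ballProfile n) := by
  unfold ballProfile; fun_prop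

lemma ballProfile_nonneg (n : ℕ) (x : ℝ) : 0 ≤ ballProfile n x := by
  unfold ballProfile; positivity

lemma ballProfile_zero (n : ℕ) : ballProfile n 0 = 1 := by simp [ballProfile]

lemma ballProfile_eq_zero {n : ℕ} (hn : n ≠ 0) {x : ℝ} (hx : 1 ≤ x) : ballProfile n x = 0 := by
  unfold ballProfile
  rw [Real.sqrt_eq_zero_of_nonpos (by nlinarith), zero_pow hn]

lemma ballProfile_le_of_le (n : ℕ) {x y : ℝ} (hx : 0 ≤ x) (hxy : x ≤ y) :
    ballProfile n y ≤ ballProfile n x := by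
  unfold ballProfile
  have : x ^ 2 ≤ y ^ 2 := by gcongr
  gcongr

lemma ballProfile_eq_rpow (n : ℕ) {x : ℝ} (hx : 0 ≤ 1 - x ^ 2) :
    ballProfile n x = (1 - x ^ 2) ^ ((n : ℝ) / 2) := by
  unfold ballProfile
  rw [Real.sqrt_eq_rpow, ← Real.rpow_natCast, ← Real.rpow_mul hx]
  congr 1; ring

lemma hasDerivAt_one_sub_sq_rpow (a : ℝ) {x : ℝ} (hx : 0 < 1 - x ^ 2) :
    HasDerivAt (fun x : ℝ => (1 - x ^ 2) ^ a) (-(2 * a) * x * (1 - x ^ 2) ^ (a - 1)) x := by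
  have h1 : HasDerivAt (fun x : ℝ => 1 - x ^ 2) (-(2 * x)) x := by
    simpa using (hasDerivAt_pow 2 x).const_sub 1
  convert h1.rpow_const (p := a) (Or.inl hx.ne') using 1
  ring

lemma hasDerivAt_deriv_one_sub_sq_rpow (a : ℝ) {x : ℝ} (hx : 0 < 1 - x ^ 2) :
    HasDerivAt (fun x : ℝ => -(2 * a) * x * (1 - x ^ 2) ^ (a - 1))
      (2 * a * (1 - x ^ 2) ^ (a - 2) * ((2 * a - 1) * x ^ 2 - 1)) x := by
  have h : HasDerivAt (fun x : ℝ => -(2 * a) * x * (1 - x ^ 2) ^ (a - 1))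
      (-(2 * a) * 1 * (1 - x ^ 2) ^ (a - 1)
        + -(2 * a) * x * (-(2 * (a - 1)) * x * (1 - x ^ 2) ^ (a - 1 - 1))) x :=
    ((hasDerivAt_id' x).const_mul (-(2 * a))).mul (hasDerivAt_one_sub_sq_rpow (a - 1) hx)
  convert h using 1
  have e : (1 - x ^ 2) ^ (a - 1) = (1 - x ^ 2) ^ (a - 2) * (1 - x ^ 2) := by
    rw [← Real.rpow_add_one hx.ne']; congr 1; ring
  have e2 : a - 1 - 1 = a - 2 := by ring
  rw [e2, e]
  ring

/-- The second derivative is a nonnegative factor times (n - 1)x² - 1, which changes sign exactly at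
1/√(n - 1). -/
lemma ballProfile_concaveOn {n : ℕ} (hn : 3 ≤ n) :
    ConcaveOn ℝ (Set.Icc 0 (1 / √((n : ℝ) - 1))) (ballProfile n) := by
  have hn' : (3 : ℝ) ≤ n := by exact_mod_cast hn
  have hc : 0 < √((n : ℝ) - 1) := Real.sqrt_pos.2 (by linarith)
  have key : ∀ x ∈ Set.Icc 0 (1 / √((n : ℝ) - 1)), ((n : ℝ) - 1) * x ^ 2 ≤ 1 := by
    intro x hx
    have h : x * √((n : ℝ) - 1) ≤ 1 := (le_div_iff₀ hc).1 hx.2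
    have h2 : (x * √((n : ℝ) - 1)) ^ 2 ≤ 1 := pow_le_one₀ (mul_nonneg hx.1 hc.le) h
    rw [mul_pow, Real.sq_sqrt (by linarith)] at h2
    linarith
  have hpos : ∀ x ∈ Set.Icc 0 (1 / √((n : ℝ) - 1)), 0 < 1 - x ^ 2 := by
    intro x hx
    nlinarith [key x hx, sq_nonneg x]
  refine ConcaveOn.congr (concaveOn_of_hasDerivWithinAt2_nonpos (convex_Icc _ _)
    (f := fun x : ℝ => (1 - x ^ 2) ^ ((n : ℝ) / 2))
    (((continuous_ballProfile n).continuousOn).congr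
      fun x hx => (ballProfile_eq_rpow n (hpos x hx).le).symm)
    (fun x hx => (hasDerivAt_one_sub_sq_rpow _ (hpos x (interior_subset hx))).hasDerivWithinAt)
    (fun x hx => (hasDerivAt_deriv_one_sub_sq_rpow _
      (hpos x (interior_subset hx))).hasDerivWithinAt)
    fun x hx => ?_) fun x hx => (ballProfile_eq_rpow n (hpos x hx).le).symm
  have := key x (interior_subset hx)
  have h3 := Real.rpow_nonneg (hpos x (interior_subset hx)).le ((n : ℝ) / 2 - 2)
  refine mul_nonpos_of_nonneg_of_nonpos (by positivity) (by nlinarith)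

lemma ballProfile_convexOn {n : ℕ} (hn : 3 ≤ n) :
    ConvexOn ℝ (Set.Icc (1 / √((n : ℝ) - 1)) 1) (ballProfile n) := by
  have hn' : (3 : ℝ) ≤ n := by exact_mod_cast hn
  have hc : 0 < √((n : ℝ) - 1) := Real.sqrt_pos.2 (by linarith)
  have key : ∀ x ∈ Set.Icc (1 / √((n : ℝ) - 1)) 1, 1 ≤ ((n : ℝ) - 1) * x ^ 2 := by
    intro x hx
    have h : 1 ≤ x * √((n : ℝ) - 1) := (div_le_iff₀ hc).1 hx.1
    have h2 : 1 ≤ (x * √((n : ℝ) - 1)) ^ 2 := one_le_pow₀ h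
    rw [mul_pow, Real.sq_sqrt (by linarith)] at h2
    linarith
  have hx0 : ∀ x ∈ Set.Icc (1 / √((n : ℝ) - 1)) 1, 0 ≤ x := fun x hx =>
    le_trans (by positivity) hx.1
  have hnn : ∀ x ∈ Set.Icc (1 / √((n : ℝ) - 1)) 1, 0 ≤ 1 - x ^ 2 := by
    intro x hx
    nlinarith [hx.2, hx0 x hx]
  have hpos : ∀ x ∈ interior (Set.Icc (1 / √((n : ℝ) - 1)) 1), 0 < 1 - x ^ 2 := by
    intro x hx
    have h0 := hx0 x (interior_subset hx)
    rw [interior_Icc] at hx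
    nlinarith [hx.2]
  -- For small n the second derivative is singular at x = 1; derivatives are needed only in the
  -- interior, continuity on the closed interval.
  refine ConvexOn.congr (convexOn_of_hasDerivWithinAt2_nonneg (convex_Icc _ _)
    (f := fun x : ℝ => (1 - x ^ 2) ^ ((n : ℝ) / 2))
    (((continuous_ballProfile n).continuousOn).congr
      fun x hx => (ballProfile_eq_rpow n (hnn x hx)).symm)
    (fun x hx => (hasDerivAt_one_sub_sq_rpow _ (hpos x hx)).hasDerivWithinAt)
    (fun x hx => (hasDerivAt_deriv_one_sub_sq_rpow _ (hpos x hx)).hasDerivWithinAt)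
    fun x hx => ?_) fun x hx => (ballProfile_eq_rpow n (hnn x hx)).symm
  have := key x (interior_subset hx)
  have h3 := Real.rpow_nonneg (hpos x hx).le ((n : ℝ) / 2 - 2)
  refine mul_nonneg (by positivity) (by nlinarith)

/-- With s = 1 - z² and k = n + 4, the right side is the second Taylor polynomial P_k of (1 -
s)^{k/2}. Multiplying by z² = 1 - s raises k by 2, and P_{k+2} - (1 - s)P_k = k(k - 2)s³/8 ≥ 0.
Induction therefore goes in steps of two, from k = 4, where equality holds, and k = 5. -/
lemma one_sub_pow_bound_of_four_le (n : ℕ) {z : ℝ} (hz : 0 ≤ z) (hz1 : z ≤ 1) :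
    z ^ (n + 4) ≤ 1 - ((n : ℝ) + 4) / 2 * (1 - z ^ 2)
      + ((n : ℝ) + 4) * ((n : ℝ) + 2) / 8 * (1 - z ^ 2) ^ 2 := by
  induction n using Nat.twoStepInduction with
  | zero => norm_num; nlinarith
  | one =>
    have h : 0 ≤ (1 - z) ^ 3 * (3 + 9 * z + 8 * z ^ 2) := by
      have := sub_nonneg.2 hz1
      positivity
    norm_num
    nlinarith
  | more n ih _ =>
    have e : z ^ (n + 2 + 4) = z ^ 2 * z ^ (n + 4) := by ring
    have h0 : 0 ≤ 1 - z ^ 2 := by nlinarith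
    have h1 := mul_le_mul_of_nonneg_left ih (sq_nonneg z)
    have h2 : 0 ≤ ((n : ℝ) + 4) * ((n : ℝ) + 2) / 8 * (1 - z ^ 2) ^ 3 := by positivity
    rw [e]
    push_cast
    nlinarith

/-- For n ≥ 4 this is the Taylor bound above. For n = 3 the third-order term has the wrong sign and
a larger `constA1` compensates: the difference of the two sides is (1 - z)²(z² + z + 1/2) with z =
√(1 - x²). -/
lemma one_sub_ballProfile_ge {n : ℕ} (hn : 3 ≤ n) {x : ℝ} (hx : 0 ≤ x) (hx1 : x ≤ 1) :
    (n : ℝ) / 2 * (x ^ 2 * (1 - constA1 (n + 1) * x ^ 2)) ≤ 1 - ballProfile n x := by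
  unfold ballProfile constA1
  have h0 : 0 ≤ 1 - x ^ 2 := by nlinarith
  set z := √(1 - x ^ 2) with hz
  have hz0 : 0 ≤ z := Real.sqrt_nonneg _
  have hz2 : z ^ 2 = 1 - x ^ 2 := Real.sq_sqrt h0
  have hz1 : z ≤ 1 := Real.sqrt_le_one.2 (by nlinarith)
  have hxz : x ^ 2 = 1 - z ^ 2 := by linarith
  rw [hxz]
  clear_value z
  rcases Nat.lt_or_ge n 4 with h4 | h4
  · obtain rfl : n = 3 := by omega
    have h : 0 ≤ (1 - z) ^ 2 * (z ^ 2 + z + 1 / 2) := by positivity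
    norm_num
    nlinarith
  · obtain ⟨k, rfl⟩ := Nat.exists_eq_add_of_le' h4
    have := one_sub_pow_bound_of_four_le k hz0 hz1
    rw [if_pos (by omega)]
    push_cast
    nlinarith

/-! ### Riemann sums against integrals -/

lemma integral_unit_le {g : ℝ → ℝ} (hg : Continuous g) {j c s : ℝ}
    (h : ∀ x ∈ Set.Icc (0 : ℝ) 1, g (j + x) ≤ c - s * x) :
    ∫ x in j..j + 1, g x ≤ c - s / 2 := by
  have e : ∫ x in j..j + 1, g x = ∫ x in (0 : ℝ)..1, g (j + x) := by
    rw [intervalIntegral.integral_comp_add_left]; simp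
  rw [e]
  calc ∫ x in (0 : ℝ)..1, g (j + x) ≤ ∫ x in (0 : ℝ)..1, (c - s * x) := by
        refine intervalIntegral.integral_mono_on zero_le_one ?_ ?_ h
        · exact Continuous.intervalIntegrable (by fun_prop) _ _
        · exact Continuous.intervalIntegrable (by fun_prop) _ _
    _ = c - s / 2 := by
        rw [intervalIntegral.integral_sub (by simp)
          (Continuous.intervalIntegrable (by fun_prop) _ _)]
        rw [intervalIntegral.integral_const, intervalIntegral.integral_const_mul, integral_id,
          smul_eq_mul]
        ring

section sums

variable {n : ℕ} {M : ℝ}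

/-- The difference between the `j`-th term of the Riemann sum and the integral over the `j`-th cell. -/
noncomputable def cellExcess (n : ℕ) (M : ℝ) (j : ℕ) : ℝ :=
  ballProfile n (j / M) - ∫ x in (j : ℝ)..(j : ℝ) + 1, ballProfile n (x / M)

lemma cellExcess_nonneg (hM : 0 < M) (j : ℕ) : 0 ≤ cellExcess n M j := by
  have hc : Continuous fun x => ballProfile n (x / M) :=
    (continuous_ballProfile n).comp (by fun_prop)
  have := integral_unit_le hc (j := j) (c := ballProfile n (j / M)) (s := 0) fun x hx => by
    have := hx.1
    rw [zero_mul, sub_zero]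
    refine ballProfile_le_of_le n (by positivity) ?_
    gcongr; linarith
  unfold cellExcess
  linarith

/-- By concavity the secant through the nodes j and j + 1, prolonged to the right, stays above the
profile on the next cell [j + 1, j + 2]. The error of that cell is thus at least half the drop over
the previous one. -/
lemma cellExcess_ge_of_concave (hn : 3 ≤ n) (hM : 0 < M) {j : ℕ}
    (hj : ((j : ℝ) + 2) ≤ M / √((n : ℝ) - 1)) :
    (ballProfile n (j / M) - ballProfile n (((j + 1 : ℕ) : ℝ) / M)) / 2
      ≤ cellExcess n M (j + 1) := by
  have hc : Continuous fun x => ballProfile n (x / M) :=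
    (continuous_ballProfile n).comp (by fun_prop)
  set G := fun x => ballProfile n (x / M) with hG
  have hmem : ∀ x : ℝ, 0 ≤ x → x ≤ j + 2 → x / M ∈ Set.Icc 0 (1 / √((n : ℝ) - 1)) := by
    intro x hx hx2
    refine ⟨by positivity, ?_⟩
    rw [div_le_iff₀ hM]
    calc x ≤ _ := hx2.trans hj
      _ = _ := by ring
  have := integral_unit_le hc (j := ((j + 1 : ℕ) : ℝ)) (c := G ((j + 1 : ℕ) : ℝ))
    (s := G j - G ((j + 1 : ℕ) : ℝ)) fun x hx => by
    -- The node j + 1 is the convex combination of j and j + 1 + x with weights x/(1 + x) and 1/(1 +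
    -- x).
    obtain ⟨hx0, hx1⟩ := hx
    have hcv := (ballProfile_concaveOn hn).2
      (hmem j (by positivity) (by linarith))
      (hmem (j + 1 + x) (by positivity) (by linarith))
      (show 0 ≤ x / (1 + x) by positivity) (show 0 ≤ 1 / (1 + x) by positivity)
      (by field_simp; ring)
    have e : (x / (1 + x)) • ((j : ℝ) / M) + (1 / (1 + x)) • ((j + 1 + x) / M)
        = ((j + 1 : ℕ) : ℝ) / M := by
      simp only [smul_eq_mul]; push_cast; field_simp; ring
    rw [e, smul_eq_mul, smul_eq_mul] at hcv
    have h3 : x * G j + G (j + 1 + x) ≤ (1 + x) * G ((j + 1 : ℕ) : ℝ) := by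
      have := mul_le_mul_of_nonneg_left hcv (by positivity : 0 ≤ 1 + x)
      refine le_trans (le_of_eq ?_) this
      simp only [hG]
      field_simp
    have e2 : ((j + 1 : ℕ) : ℝ) + x = j + 1 + x := by push_cast; ring
    rw [e2]
    linarith
  unfold cellExcess
  simp only [hG] at this
  linarith

/-- By convexity the chord of the cell itself lies above the profile, so the error is at least half
the drop over the same cell. If the cell reaches beyond M, where the profile is 0, the chord from j
to M is used; it lies below the one from j to j + 1. -/
lemma cellExcess_ge_of_convex (hn : 3 ≤ n) (hM : 0 < M) {j : ℕ}
    (hj : M / √((n : ℝ) - 1) ≤ j) :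
    (ballProfile n (j / M) - ballProfile n (((j + 1 : ℕ) : ℝ) / M)) / 2 ≤ cellExcess n M j := by
  have hc : Continuous fun x => ballProfile n (x / M) :=
    (continuous_ballProfile n).comp (by fun_prop)
  set G := fun x => ballProfile n (x / M) with hG
  have hz : ∀ x : ℝ, M ≤ x → G x = 0 := fun x hx =>
    ballProfile_eq_zero (by omega) ((one_le_div hM).2 hx)
  have hmem : ∀ x : ℝ, j ≤ x → x ≤ M → x / M ∈ Set.Icc (1 / √((n : ℝ) - 1)) 1 := by
    intro x hx hx2
    refine ⟨?_, (div_le_one hM).2 hx2⟩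
    rw [le_div_iff₀ hM]
    calc _ = M / √((n : ℝ) - 1) := by ring
      _ ≤ _ := hj.trans hx
  have chord : ∀ y x : ℝ, (j : ℝ) + x ≤ y → y ≤ M → 0 ≤ x → (j : ℝ) < y →
      G (j + x) ≤ (1 - x / (y - j)) * G j + (x / (y - j)) * G y := by
    intro y x hxy hyM hx hjy
    have hp : 0 < y - j := by linarith
    have hcv := (ballProfile_convexOn hn).2 (hmem j le_rfl (by linarith)) (hmem y hjy.le hyM)
      (show 0 ≤ 1 - x / (y - j) by rw [sub_nonneg, div_le_one hp]; linarith)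
      (show 0 ≤ x / (y - j) by positivity) (by ring)
    have e : (1 - x / (y - j)) • ((j : ℝ) / M) + (x / (y - j)) • (y / M) = (j + x) / M := by
      simp only [smul_eq_mul]; field_simp; ring
    rw [e] at hcv
    exact hcv
  have hG0 : 0 ≤ G j := ballProfile_nonneg _ _
  have := integral_unit_le hc (j := (j : ℝ)) (c := G j)
    (s := G j - G ((j + 1 : ℕ) : ℝ)) fun x hx => by
    obtain ⟨hx0, hx1⟩ := hx
    push_cast
    rcases le_or_gt ((j : ℝ) + 1) M with h1 | h1
    · have := chord (j + 1) x (by linarith) h1 hx0 (by linarith)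
      have e : (j : ℝ) + 1 - j = 1 := by ring
      rw [e, div_one] at this
      linarith
    · rw [hz _ h1.le, sub_zero]
      rcases le_or_gt M (j + x) with h2 | h2
      · rw [hz _ h2]
        nlinarith
      · have := chord M x h2.le le_rfl hx0 (by linarith)
        rw [hz M le_rfl, mul_zero, add_zero] at this
        refine this.trans ?_
        have : x ≤ x / (M - j) := by
          rw [le_div_iff₀ (by linarith)]; nlinarith
        nlinarith
  unfold cellExcess
  simp only [hG] at this
  linarith

/-- The integral `∫₀¹ (1 - x²)^{n/2} dx`. -/
noncomputable def ballProfileIntegral (n : ℕ) : ℝ := ∫ x in (0 : ℝ)..1, ballProfile n x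

lemma sum_ballProfile_eq (hn : n ≠ 0) (hM : 0 < M) :
    ∑ j ∈ Finset.range (⌊M⌋₊ + 1), ballProfile n (j / M) =
      ballProfileIntegral n * M + ∑ j ∈ Finset.range (⌊M⌋₊ + 1), cellExcess n M j := by
  have hc : Continuous fun x => ballProfile n (x / M) :=
    (continuous_ballProfile n).comp (by fun_prop)
  unfold cellExcess
  rw [Finset.sum_sub_distrib]
  have h := intervalIntegral.sum_integral_adjacent_intervals (μ := volume)
    (f := fun x => ballProfile n (x / M)) (a := fun j : ℕ => (j : ℝ)) (n := ⌊M⌋₊ + 1)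
    fun k _ => hc.intervalIntegrable _ _
  have h2 : ∫ x in ((0 : ℕ) : ℝ)..((⌊M⌋₊ + 1 : ℕ) : ℝ), ballProfile n (x / M)
      = ballProfileIntegral n * M := by
    rw [← intervalIntegral.integral_add_adjacent_intervals (b := M)
      (hc.intervalIntegrable _ _) (hc.intervalIntegrable _ _)]
    -- The cells cover [0, ⌊M⌋ + 1]; the piece beyond M contributes nothing because the profile
    -- vanishes there.
    have hlt : M < ((⌊M⌋₊ + 1 : ℕ) : ℝ) := by push_cast; exact Nat.lt_floor_add_one M
    have h3 : ∫ x in M..((⌊M⌋₊ + 1 : ℕ) : ℝ), ballProfile n (x / M) = 0 := by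
      rw [intervalIntegral.integral_congr (g := fun _ => 0)]
      · simp
      · intro x hx
        rw [Set.uIcc_of_le hlt.le] at hx
        exact ballProfile_eq_zero hn ((one_le_div hM).2 hx.1)
    rw [h3, add_zero, intervalIntegral.integral_comp_div (ballProfile n) hM.ne']
    simp [ballProfileIntegral, hM.ne', mul_comm]
  push_cast at h h2 ⊢
  rw [h, h2]
  ring

lemma sum_ballProfile_ge_integral (hn : n ≠ 0) (hM : 0 < M) :
    ballProfileIntegral n * M ≤ ∑ j ∈ Finset.range (⌊M⌋₊ + 1), ballProfile n (j / M) := by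
  rw [sum_ballProfile_eq hn hM]
  have := Finset.sum_nonneg fun j (_ : j ∈ Finset.range (⌊M⌋₊ + 1)) =>
    cellExcess_nonneg (n := n) hM j
  linarith

lemma one_le_sum_ballProfile (n : ℕ) (M : ℝ) :
    1 ≤ ∑ j ∈ Finset.range (⌊M⌋₊ + 1), ballProfile n (j / M) := by
  rw [Finset.sum_range_succ']
  simp only [Nat.cast_zero, zero_div, ballProfile_zero, le_add_iff_nonneg_left]
  exact Finset.sum_nonneg fun _ _ => ballProfile_nonneg _ _

/-- Let p = ⌊M/√(n - 1)⌋. The cells 1, …, p - 1 lie in the concave range and their bounds telescope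
to half of 1 - f((p - 1)/M). The cells from p + 1 on lie in the convex range and telescope to half
of f((p + 1)/M), since f vanishes at the last node. Cell 0 and cell p, which contains the inflection
point, contribute only a nonnegative error. -/
lemma sum_ballProfile_ge_improved (hn : 3 ≤ n) (hM : √((n : ℝ) - 1) ≤ M) :
    ballProfileIntegral n * M
      + (1 - ballProfile n (((⌊M / √((n : ℝ) - 1)⌋ : ℝ) - 1) / M)) / 2
      + ballProfile n (((⌊M / √((n : ℝ) - 1)⌋ : ℝ) + 1) / M) / 2 ≤
    ∑ j ∈ Finset.range (⌊M⌋₊ + 1), ballProfile n (j / M) := by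
  have hn' : (3 : ℝ) ≤ n := by exact_mod_cast hn
  have hc1 : 1 ≤ √((n : ℝ) - 1) := Real.one_le_sqrt.2 (by linarith)
  have hc : 0 < √((n : ℝ) - 1) := by linarith
  have hM0 : 0 < M := by linarith
  have hq0 : 0 ≤ M / √((n : ℝ) - 1) := by positivity
  have hfl : (⌊M / √((n : ℝ) - 1)⌋ : ℝ) = (⌊M / √((n : ℝ) - 1)⌋₊ : ℝ) :=
    (natCast_floor_eq_intCast_floor hq0).symm
  rw [hfl, sum_ballProfile_eq (by omega) hM0]
  have hp1 : 1 ≤ ⌊M / √((n : ℝ) - 1)⌋₊ := Nat.one_le_floor_iff _ |>.2 ((one_le_div hc).2 hM)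
  have hpm : ⌊M / √((n : ℝ) - 1)⌋₊ ≤ ⌊M⌋₊ := Nat.floor_le_floor (div_le_self hM0.le hc1)
  have hple := Nat.floor_le hq0
  have hplt := Nat.lt_floor_add_one (M / √((n : ℝ) - 1))
  generalize ⌊M / √((n : ℝ) - 1)⌋₊ = p at *
  -- From here p = q + 1, which avoids natural subtraction in p - 1.
  obtain ⟨q, rfl⟩ := Nat.exists_eq_add_of_le' hp1
  obtain ⟨r, hr⟩ := Nat.exists_eq_add_of_le hpm
  have hMr : M < ((q + 1 + 1 + r : ℕ) : ℝ) := by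
    have := Nat.lt_floor_add_one M
    rw [hr] at this
    push_cast at this ⊢
    linarith
  have hrange : ⌊M⌋₊ + 1 = (q + 1 + 1) + r := by omega
  rw [hrange, Finset.sum_range_add, Finset.sum_range_succ]
  have h1 : (1 - ballProfile n (q / M)) / 2 ≤ ∑ j ∈ Finset.range (q + 1), cellExcess n M j := by
    rw [Finset.sum_range_succ']
    have h := Finset.sum_range_sub' (fun j : ℕ => ballProfile n (j / M) / 2) q
    have h2 : ∑ j ∈ Finset.range q, (ballProfile n (j / M) / 2
        - ballProfile n (((j + 1 : ℕ) : ℝ) / M) / 2) ≤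
        ∑ j ∈ Finset.range q, cellExcess n M (j + 1) := by
      refine Finset.sum_le_sum fun j hj => ?_
      rw [← sub_div]
      refine cellExcess_ge_of_concave hn hM0 (le_trans ?_ hple)
      have : j + 1 ≤ q := Finset.mem_range.1 hj
      have : (j : ℝ) + 1 ≤ q := by exact_mod_cast this
      push_cast
      linarith
    have h3 := cellExcess_nonneg (n := n) hM0 0
    rw [h] at h2
    simp only [Nat.cast_zero, zero_div, ballProfile_zero] at h2
    linarith
  have h2 : ballProfile n (((q + 1 + 1 : ℕ) : ℝ) / M) / 2 ≤
      ∑ j ∈ Finset.range r, cellExcess n M (q + 1 + 1 + j) := by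
    have h := Finset.sum_range_sub' (fun j : ℕ => ballProfile n ((q + 1 + 1 + j : ℕ) / M) / 2) r
    have h2 : ∑ j ∈ Finset.range r, (ballProfile n ((q + 1 + 1 + j : ℕ) / M) / 2
        - ballProfile n ((q + 1 + 1 + (j + 1) : ℕ) / M) / 2) ≤
        ∑ j ∈ Finset.range r, cellExcess n M (q + 1 + 1 + j) := by
      refine Finset.sum_le_sum fun j hj => ?_
      rw [← sub_div]
      refine cellExcess_ge_of_convex hn hM0 (hplt.le.trans ?_)
      push_cast
      have : (0 : ℝ) ≤ j := by positivity
      linarith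
    rw [h, ballProfile_eq_zero (x := ((q + 1 + 1 + r : ℕ) : ℝ) / M) (by omega)
      ((one_le_div hM0).2 hMr.le)] at h2
    simp only [add_zero] at h2
    linarith
  have h3 := cellExcess_nonneg (n := n) hM0 (q + 1)
  push_cast at h1 h2 h3 ⊢
  rw [add_sub_cancel_right]
  linarith

/-- For n = 2 the summand is 1 - (j/M)², so the sum is a closed expression in M and m = ⌊M⌋. The
deficit factors with (M - m)(m + 1 - M), which is nonnegative and vanishes at integers. -/
lemma sum_ballProfile_two_ge (hM : 0 < M) :
    2 / 3 * M + 1 / 2 - 1 / (6 * M) ≤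
      ∑ j ∈ Finset.range (⌊M⌋₊ + 1), ballProfile 2 (j / M) := by
  have h1 := Nat.floor_le hM.le
  have h2 := Nat.lt_floor_add_one M
  have h3 : ∑ j ∈ Finset.range (⌊M⌋₊ + 1), ballProfile 2 (j / M) =
      ∑ j ∈ Finset.range (⌊M⌋₊ + 1), (1 - ((j : ℝ)) ^ 2 / M ^ 2) := by
    refine Finset.sum_congr rfl fun j hj => ?_
    have : j ≤ ⌊M⌋₊ := Nat.lt_succ_iff.1 (Finset.mem_range.1 hj)
    have : (j : ℝ) ≤ ⌊M⌋₊ := by exact_mod_cast this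
    unfold ballProfile
    rw [Real.sq_sqrt, div_pow]
    rw [sub_nonneg]
    exact pow_le_one₀ (by positivity) ((div_le_one hM).2 (by linarith))
  have h4 : ∀ m : ℕ, ∑ j ∈ Finset.range (m + 1), ((j : ℝ)) ^ 2
      = m * (m + 1) * (2 * m + 1) / 6 := by
    intro m
    induction m with
    | zero => simp
    | succ k ih => rw [Finset.sum_range_succ, ih]; push_cast; ring
  rw [h3, Finset.sum_sub_distrib, ← Finset.sum_div, h4]
  generalize ⌊M⌋₊ = m at *
  simp only [Finset.sum_const, Finset.card_range, nsmul_eq_mul, mul_one]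
  push_cast
  have hf : 0 ≤ 4 * (M - m) * (m + 1 - M) * (M + (2 * m + 1) / 4) := by
    have a1 : 0 ≤ M - m := by linarith
    have a2 : 0 ≤ m + 1 - M := by linarith
    positivity
  rw [← sub_nonneg]
  have e : (m + 1 : ℝ) - m * (m + 1) * (2 * m + 1) / 6 / M ^ 2 - (2 / 3 * M + 1 / 2 - 1 / (6 * M))
      = 4 * (M - m) * (m + 1 - M) * (M + (2 * m + 1) / 4) / (6 * M ^ 2) := by
    field_simp; ring
  rw [e]
  positivity

end sums

/-! ### Splitting off the last coordinate; volumes of balls -/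

/-- The splitting `ℝⁿ⁺¹ ≃ ℝⁿ × ℝ` along the last coordinate. -/
noncomputable def splitLast (n : ℕ) :
    EuclideanSpace ℝ (Fin (n + 1)) ≃L[ℝ] EuclideanSpace ℝ (Fin n) × ℝ :=
  LinearEquiv.toContinuousLinearEquiv
    { toFun := fun x => (WithLp.toLp 2 (fun i : Fin n => x i.castSucc), x (Fin.last n))
      map_add' := fun x y => rfl
      map_smul' := fun c x => rfl
      invFun := fun p => WithLp.toLp 2 (Fin.snoc (α := fun _ => ℝ) (fun i => p.1 i) p.2)
      left_inv := fun x => by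
        ext i
        refine Fin.lastCases ?_ (fun j => ?_) i <;> simp
      right_inv := fun p => by
        ext <;> simp }

lemma splitLast_apply {n : ℕ} (x : EuclideanSpace ℝ (Fin (n + 1))) :
    splitLast n x = (WithLp.toLp 2 (fun i : Fin n => x i.castSucc), x (Fin.last n)) := rfl

lemma inner_eq_splitLast {n : ℕ} (x y : EuclideanSpace ℝ (Fin (n + 1))) :
    inner ℝ x y = inner ℝ (splitLast n x).1 (splitLast n y).1
      + (splitLast n x).2 * (splitLast n y).2 := by
  simp [PiLp.inner_apply, splitLast_apply, Fin.sum_univ_castSucc, mul_comm]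

lemma norm_sq_eq_splitLast {n : ℕ} (x : EuclideanSpace ℝ (Fin (n + 1))) :
    ‖x‖ ^ 2 = ‖(splitLast n x).1‖ ^ 2 + (splitLast n x).2 ^ 2 := by
  rw [← real_inner_self_eq_norm_sq, ← real_inner_self_eq_norm_sq, inner_eq_splitLast, sq]

lemma measurePreserving_splitLast (n : ℕ) :
    MeasurePreserving (splitLast n) volume volume := by
  have h1 := EuclideanSpace.volume_preserving_symm_measurableEquiv_toLp (Fin (n + 1))
  have h2 := volume_preserving_piFinSuccAbove (fun _ : Fin (n + 1) => ℝ) (Fin.last n)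
  have h3 : MeasurePreserving (Prod.swap : ℝ × (Fin n → ℝ) → (Fin n → ℝ) × ℝ) volume volume :=
    Measure.measurePreserving_swap
  have h4 := ((EuclideanSpace.volume_preserving_symm_measurableEquiv_toLp (Fin n)).symm).prod
    (MeasurePreserving.id (volume : Measure ℝ))
  have h := h4.comp (h3.comp (h2.comp h1))
  refine (congrArg (fun f => MeasurePreserving f volume
    (volume : Measure (EuclideanSpace ℝ (Fin n) × ℝ))) (funext fun x => ?_)).mpr h
  refine Prod.ext ?_ rfl
  ext i
  simp only [splitLast_apply, MeasurableEquiv.piFinSuccAbove, MeasurableEquiv.toLp,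
    Fin.insertNthEquiv_last]
  rfl

lemma measurableEmbedding_splitLast (n : ℕ) : MeasurableEmbedding (splitLast n) :=
  (splitLast n).toHomeomorph.measurableEmbedding

lemma productDomain_eq_preimage {n : ℕ} (D : Set (EuclideanSpace ℝ (Fin n))) (I : Set ℝ) :
    productDomain D I = splitLast n ⁻¹' (D ×ˢ I) := rfl

lemma measurePreserving_splitLast_productDomain {n : ℕ} {D : Set (EuclideanSpace ℝ (Fin n))}
    {I : Set ℝ} (hD : MeasurableSet D) (hI : MeasurableSet I) :
    MeasurePreserving (splitLast n) (volume.restrict (productDomain D I))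
      ((volume.restrict D).prod (volume.restrict I)) := by
  rw [Measure.prod_restrict, productDomain_eq_preimage]
  exact (measurePreserving_splitLast n).restrict_preimage (hD.prod hI)

lemma volume_real_productDomain {n : ℕ} {D : Set (EuclideanSpace ℝ (Fin n))}
    {I : Set ℝ} (hD : MeasurableSet D) (hI : MeasurableSet I) :
    volume.real (productDomain D I) = volume.real D * volume.real I := by
  rw [measureReal_def, productDomain_eq_preimage,
    (measurePreserving_splitLast n).measure_preimage (hD.prod hI).nullMeasurableSet,
    Measure.volume_eq_prod, Measure.prod_prod, ENNReal.toReal_mul]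
  rfl

/-- The slice of the unit ball at height t is a ball of radius √(1 - t²), of volume ω_n times the
profile at t. -/
lemma unitBallVol_succ {n : ℕ} (hn : n ≠ 0) :
    unitBallVol (n + 1) = 2 * unitBallVol n * ballProfileIntegral n := by
  have : Nonempty (Fin n) := ⟨⟨0, by omega⟩⟩
  set S : Set (EuclideanSpace ℝ (Fin n) × ℝ) := {p | ‖p.1‖ ^ 2 + p.2 ^ 2 < 1} with hS
  have hSm : MeasurableSet S := (isOpen_lt (by fun_prop) continuous_const).measurableSet
  have e1 : Metric.ball (0 : EuclideanSpace ℝ (Fin (n + 1))) 1 = splitLast n ⁻¹' S := by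
    ext x
    simp only [mem_ball_zero_iff, hS, Set.mem_preimage, Set.mem_ofPred_eq]
    rw [← norm_sq_eq_splitLast, sq_lt_one_iff₀ (norm_nonneg _)]
  have hvol : volume (Metric.ball (0 : EuclideanSpace ℝ (Fin n)) 1) =
      ENNReal.ofReal (unitBallVol n) := by
    rw [unitBallVol, ofReal_measureReal (measure_ball_lt_top).ne]
  have hslice : ∀ t : ℝ, volume ((fun x => (x, t)) ⁻¹' S) =
      ENNReal.ofReal (ballProfile n t * unitBallVol n) := by
    intro t
    have : ((fun x => (x, t)) ⁻¹' S) =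
        Metric.ball (0 : EuclideanSpace ℝ (Fin n)) (√(1 - t ^ 2)) := by
      ext x
      simp only [hS, Set.mem_preimage, Set.mem_ofPred_eq, mem_ball_zero_iff]
      rw [Real.lt_sqrt (norm_nonneg _), lt_sub_iff_add_lt]
    rw [this, Measure.addHaar_ball _ _ (Real.sqrt_nonneg _), hvol, finrank_euclideanSpace_fin,
      ENNReal.ofReal_mul (ballProfile_nonneg _ _)]
    rfl
  have hsupp : Function.support (ballProfile n) ⊆ Set.Ioc (-1) 1 := by
    intro t ht
    by_contra hc
    refine ht ?_
    unfold ballProfile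
    rw [Real.sqrt_eq_zero_of_nonpos, zero_pow hn]
    rw [Set.mem_Ioc, not_and_or, not_lt, not_le] at hc
    rcases hc with hc | hc <;> nlinarith
  have hsymm : ∫ t in (-1 : ℝ)..1, ballProfile n t = 2 * ballProfileIntegral n := by
    rw [← intervalIntegral.integral_add_adjacent_intervals (b := 0)
      ((continuous_ballProfile n).intervalIntegrable _ _)
      ((continuous_ballProfile n).intervalIntegrable _ _)]
    have : ∫ t in (-1 : ℝ)..0, ballProfile n t = ∫ t in (0 : ℝ)..1, ballProfile n t := by
      have := intervalIntegral.integral_comp_neg (a := 0) (b := 1) (ballProfile n)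
      rw [neg_zero] at this
      rw [← this]
      simp [ballProfile]
    rw [this, ballProfileIntegral]; ring
  have hint : Integrable (ballProfile n) := by
    refine (integrableOn_iff_integrable_of_support_subset hsupp).1 ?_
    exact ((continuous_ballProfile n).integrableOn_Icc).mono_set Set.Ioc_subset_Icc_self
  have hnn : ∀ t : ℝ, 0 ≤ ballProfile n t * unitBallVol n := fun t =>
    mul_nonneg (ballProfile_nonneg _ _) measureReal_nonneg
  rw [unitBallVol, measureReal_def, e1,
    (measurePreserving_splitLast n).measure_preimage hSm.nullMeasurableSet,
    Measure.volume_eq_prod, Measure.prod_apply_symm hSm]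
  simp only [hslice]
  rw [← ofReal_integral_eq_lintegral_ofReal (hint.mul_const _)
    (Filter.Eventually.of_forall hnn), ENNReal.toReal_ofReal (integral_nonneg hnn), integral_mul_const,
    ← setIntegral_eq_integral_of_forall_compl_eq_zero (s := Set.Ioc (-1) 1)
      (fun x hx => by_contra fun h => hx (hsupp h)),
    ← intervalIntegral.integral_of_le (by norm_num), hsymm]
  ring

lemma unitBallVol_eq {n : ℕ} (hn : n ≠ 0) :
    unitBallVol n = √Real.pi ^ n / Real.Gamma (n / 2 + 1) := by
  have : Nonempty (Fin n) := ⟨⟨0, by omega⟩⟩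
  rw [unitBallVol, measureReal_def, EuclideanSpace.volume_ball]
  simp only [ENNReal.ofReal_one, one_pow, one_mul, Fintype.card_fin]
  rw [ENNReal.toReal_ofReal]
  exact div_nonneg (by positivity) (Real.Gamma_nonneg_of_nonneg (by positivity))

/-- Identifies the Gamma quotient R of the small-μ bound as 1/∫₀¹ f, so that there 1 - M ∫₀¹ f = (R
- M) ∫₀¹ f. -/
lemma ballProfileIntegral_mul_Gamma {n : ℕ} (hn : n ≠ 0) :
    ballProfileIntegral n * (2 * Real.Gamma (((n + 1 : ℕ) + 2) / 2) /
      (√Real.pi * Real.Gamma (((n + 1 : ℕ) + 1) / 2))) = 1 := by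
  have h := unitBallVol_succ hn
  rw [unitBallVol_eq hn, unitBallVol_eq (by omega : n + 1 ≠ 0)] at h
  have e1 : (((n + 1 : ℕ) : ℝ) + 2) / 2 = (n + 1 : ℕ) / 2 + 1 := by ring
  have e2 : (((n + 1 : ℕ) : ℝ) + 1) / 2 = (n : ℝ) / 2 + 1 := by push_cast; ring
  rw [e1, e2]
  have g1 : 0 < Real.Gamma ((n + 1 : ℕ) / 2 + 1) := Real.Gamma_pos_of_pos (by positivity)
  have g2 : 0 < Real.Gamma ((n : ℝ) / 2 + 1) := Real.Gamma_pos_of_pos (by positivity)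
  have hp : 0 < √Real.pi := Real.sqrt_pos.2 Real.pi_pos
  field_simp at h ⊢
  rw [pow_succ] at h
  have : √Real.pi ^ n ≠ 0 := by positivity
  apply mul_left_cancel₀ this
  linear_combination -h

/-! ### Tensoring L² functions with a bounded function of the last variable -/

section lift

variable {n : ℕ} {X : Type*} [NormedAddCommGroup X] [InnerProductSpace ℝ X]
  {μ : Measure (EuclideanSpace ℝ (Fin n))} {ν : Measure ℝ}
  {ρ : Measure (EuclideanSpace ℝ (Fin (n + 1)))}

lemma ae_comp_splitLast_fst (hp : MeasurePreserving (splitLast n) ρ (μ.prod ν))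
    {P : EuclideanSpace ℝ (Fin n) → Prop} (h : ∀ᵐ y ∂μ, P y) :
    ∀ᵐ x ∂ρ, P (splitLast n x).1 :=
  hp.quasiMeasurePreserving.ae (Measure.quasiMeasurePreserving_fst.ae h)

lemma ae_comp_splitLast_snd (hp : MeasurePreserving (splitLast n) ρ (μ.prod ν))
    {P : ℝ → Prop} (h : ∀ᵐ t ∂ν, P t) : ∀ᵐ x ∂ρ, P (splitLast n x).2 :=
  hp.quasiMeasurePreserving.ae (Measure.quasiMeasurePreserving_snd.ae h)

lemma integral_splitLast (hp : MeasurePreserving (splitLast n) ρ (μ.prod ν))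
    (F : EuclideanSpace ℝ (Fin n) × ℝ → ℝ) :
    ∫ x, F (splitLast n x) ∂ρ = ∫ z, F z ∂(μ.prod ν) :=
  hp.integral_comp (measurableEmbedding_splitLast n) F

variable [IsFiniteMeasure ν]

lemma memLp_prod_smul (c : ℝ →ᵇ ℝ) {u : EuclideanSpace ℝ (Fin n) → X} (hu : MemLp u 2 μ) :
    MemLp (fun z : EuclideanSpace ℝ (Fin n) × ℝ => c z.2 • u z.1) 2 (μ.prod ν) := by
  have h := hu.comp_fst ν
  refine h.of_le_mul (c := ‖c‖) ?_ (Filter.Eventually.of_forall fun z => ?_)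
  · exact ((c.continuous.comp continuous_snd).aestronglyMeasurable).smul h.aestronglyMeasurable
  · rw [norm_smul]
    gcongr
    exact c.norm_coe_le_norm _

lemma memLp_lift (hp : MeasurePreserving (splitLast n) ρ (μ.prod ν)) (c : ℝ →ᵇ ℝ)
    {u : EuclideanSpace ℝ (Fin n) → X} (hu : MemLp u 2 μ) :
    MemLp (fun x => c (splitLast n x).2 • u (splitLast n x).1) 2 ρ :=
  (memLp_prod_smul c hu).comp_measurePreserving hp

/-- The linear map `u ↦ u ⊗ c` from `L²(μ)` to `L²` of the product measure. -/
noncomputable def liftLinear (hp : MeasurePreserving (splitLast n) ρ (μ.prod ν)) (c : ℝ →ᵇ ℝ) :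
    Lp X 2 μ →ₗ[ℝ] Lp X 2 ρ where
  toFun u := (memLp_lift hp c (Lp.memLp u)).toLp _
  map_add' u u' := by
    rw [← MemLp.toLp_add, MemLp.toLp_eq_toLp_iff]
    filter_upwards [ae_comp_splitLast_fst hp (Lp.coeFn_add u u')] with x hx
    rw [Pi.add_apply, hx, Pi.add_apply, smul_add]
  map_smul' r u := by
    rw [RingHom.id_apply, ← MemLp.toLp_const_smul, MemLp.toLp_eq_toLp_iff]
    filter_upwards [ae_comp_splitLast_fst hp (Lp.coeFn_smul r u)] with x hx
    rw [Pi.smul_apply, hx, Pi.smul_apply, smul_comm]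

lemma coeFn_liftLinear (hp : MeasurePreserving (splitLast n) ρ (μ.prod ν)) (c : ℝ →ᵇ ℝ)
    (u : Lp X 2 μ) :
    liftLinear hp c u =ᵐ[ρ] fun x => c (splitLast n x).2 • u (splitLast n x).1 :=
  (memLp_lift hp c (Lp.memLp u)).coeFn_toLp

variable [SFinite μ]

lemma inner_liftLinear (hp : MeasurePreserving (splitLast n) ρ (μ.prod ν)) (c c' : ℝ →ᵇ ℝ)
    (u u' : Lp X 2 μ) :
    inner ℝ (liftLinear hp c u) (liftLinear hp c' u') =
      inner ℝ u u' * ∫ t, c t * c' t ∂ν := by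
  rw [L2.inner_def, L2.inner_def, ← integral_prod_mul, ← integral_splitLast hp]
  refine integral_congr_ae ?_
  filter_upwards [coeFn_liftLinear hp c u, coeFn_liftLinear hp c' u'] with x h1 h2
  rw [h1, h2, real_inner_smul_left, real_inner_smul_right]
  ring

/-- The operator `u ↦ u ⊗ c` from `L²(μ)` to `L²` of the product measure. -/
noncomputable def lift (hp : MeasurePreserving (splitLast n) ρ (μ.prod ν)) (c : ℝ →ᵇ ℝ) :
    Lp X 2 μ →L[ℝ] Lp X 2 ρ :=
  (liftLinear hp c).mkContinuous (√(∫ t, c t * c t ∂ν)) fun u => by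
    have h0 : 0 ≤ ∫ t, c t * c t ∂ν := integral_nonneg fun t => mul_self_nonneg _
    refine le_of_sq_le_sq ?_ (by positivity)
    rw [mul_pow, Real.sq_sqrt h0, ← real_inner_self_eq_norm_sq, inner_liftLinear,
      real_inner_self_eq_norm_sq, mul_comm]

lemma coeFn_lift (hp : MeasurePreserving (splitLast n) ρ (μ.prod ν)) (c : ℝ →ᵇ ℝ)
    (u : Lp X 2 μ) :
    lift hp c u =ᵐ[ρ] fun x => c (splitLast n x).2 • u (splitLast n x).1 :=
  coeFn_liftLinear hp c u

lemma inner_lift (hp : MeasurePreserving (splitLast n) ρ (μ.prod ν)) (c c' : ℝ →ᵇ ℝ)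
    (u u' : Lp X 2 μ) :
    inner ℝ (lift hp c u) (lift hp c' u') = inner ℝ u u' * ∫ t, c t * c' t ∂ν :=
  inner_liftLinear hp c c' u u'

/-- The adjoint of u ↦ u ⊗ c is the fibre average w ↦ ∫ c(t) w(·, t) dν. Working with the adjoint
avoids slicing L² classes. -/
lemma integral_inner_adjoint_lift [CompleteSpace X]
    (hp : MeasurePreserving (splitLast n) ρ (μ.prod ν)) (c : ℝ →ᵇ ℝ)
    {f : EuclideanSpace ℝ (Fin n) → X} (hf : MemLp f 2 μ) (w : Lp X 2 ρ) :
    ∫ y, inner ℝ (f y) (ContinuousLinearMap.adjoint (lift hp c) w y) ∂μ =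
      ∫ x, inner ℝ (c (splitLast n x).2 • f (splitLast n x).1) (w x) ∂ρ := by
  have h := ContinuousLinearMap.adjoint_inner_right (lift hp c) (hf.toLp f) w
  rw [L2.inner_def, L2.inner_def] at h
  refine Eq.trans (integral_congr_ae ?_) (h.trans (integral_congr_ae ?_))
  · filter_upwards [hf.coeFn_toLp] with y hy
    rw [hy]
  · filter_upwards [coeFn_lift hp c (hf.toLp f),
      ae_comp_splitLast_fst hp hf.coeFn_toLp] with x h1 h2
    rw [h1, h2]

end lift

/-! ### Trigonometric factors and cutoffs on the interval -/

/-- The bounded continuous function `t ↦ cos (κ (t - a))`. -/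
noncomputable def cosB (κ a : ℝ) : ℝ →ᵇ ℝ :=
  BoundedContinuousFunction.ofNormedAddCommGroup (fun t => Real.cos (κ * (t - a)))
    (by fun_prop) 1 fun t => Real.abs_cos_le_one _

/-- The bounded continuous function `t ↦ sin (κ (t - a))`. -/
noncomputable def sinB (κ a : ℝ) : ℝ →ᵇ ℝ :=
  BoundedContinuousFunction.ofNormedAddCommGroup (fun t => Real.sin (κ * (t - a)))
    (by fun_prop) 1 fun t => Real.abs_sin_le_one _

@[simp] lemma cosB_apply (κ a t : ℝ) : cosB κ a t = Real.cos (κ * (t - a)) := rfl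

@[simp] lemma sinB_apply (κ a t : ℝ) : sinB κ a t = Real.sin (κ * (t - a)) := rfl

lemma hasDerivAt_cosB (κ a t : ℝ) : HasDerivAt (cosB κ a) (-κ * sinB κ a t) t := by
  have h : HasDerivAt (fun t : ℝ => κ * (t - a)) κ t := by
    simpa using ((hasDerivAt_id t).sub_const a).const_mul κ
  exact h.cos.congr_deriv (by rw [sinB_apply]; ring)

lemma hasDerivAt_sinB (κ a t : ℝ) : HasDerivAt (sinB κ a) (κ * cosB κ a t) t := by
  have h : HasDerivAt (fun t : ℝ => κ * (t - a)) κ t := by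
    simpa using ((hasDerivAt_id t).sub_const a).const_mul κ
  exact h.sin.congr_deriv (by rw [cosB_apply]; ring)

lemma contDiff_cosB (κ a : ℝ) {m : WithTop ℕ∞} : ContDiff ℝ m (cosB κ a) := by
  change ContDiff ℝ m fun t => Real.cos (κ * (t - a))
  fun_prop

lemma contDiff_sinB (κ a : ℝ) {m : WithTop ℕ∞} : ContDiff ℝ m (sinB κ a) := by
  change ContDiff ℝ m fun t => Real.sin (κ * (t - a))
  fun_prop

/-- The sine vanishes at both ends, so it is bounded by κ(t - a) and by κ(b - t). Weighting these by
b - t and t - a and adding gives the product bound, which absorbs the derivatives of the cutoffs. -/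
lemma abs_sinB_mul_le {κ a b : ℝ} (hab : a < b) (hκ : 0 ≤ κ)
    (hsin : ∃ j : ℕ, κ * (b - a) = j * Real.pi)
    {t : ℝ} (ht : t ∈ Set.Ioo a b) :
    |sinB κ a t| ≤ 2 * κ / (b - a) * ((t - a) * (b - t)) := by
  obtain ⟨ht1, ht2⟩ := ht
  have hL : 0 < b - a := sub_pos.2 hab
  have h1 : |sinB κ a t| ≤ κ * (t - a) := by
    refine (Real.abs_sin_le_abs).trans (le_of_eq (abs_of_nonneg ?_))
    exact mul_nonneg hκ (by linarith)
  have h2 : |sinB κ a t| ≤ κ * (b - t) := by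
    obtain ⟨j, hj⟩ := hsin
    have e : κ * (t - a) = j * Real.pi - κ * (b - t) := by rw [← hj]; ring
    rw [sinB_apply, e, Real.sin_nat_mul_pi_sub, abs_neg, abs_mul, abs_pow, abs_neg, abs_one,
      one_pow, one_mul]
    refine (Real.abs_sin_le_abs).trans (le_of_eq (abs_of_nonneg ?_))
    exact mul_nonneg hκ (by linarith)
  rw [div_mul_eq_mul_div, le_div_iff₀ hL]
  have h3 := abs_nonneg (sinB κ a t)
  nlinarith [mul_le_mul_of_nonneg_right h1 (sub_pos.2 ht2).le,
    mul_le_mul_of_nonneg_right h2 (sub_pos.2 ht1).le]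

lemma integral_cosB_sq_pos {κ a b : ℝ} (hab : a < b) :
    0 < ∫ t in Set.Ioo a b, cosB κ a t * cosB κ a t := by
  rw [← integral_Ioc_eq_integral_Ioo, ← intervalIntegral.integral_of_le hab.le]
  refine intervalIntegral.integral_pos hab (by fun_prop) (fun t _ => mul_self_nonneg _)
    ⟨a, Set.left_mem_Icc.2 hab.le, by simp⟩

lemma exists_bound_deriv_smoothTransition :
    ∃ K, 0 ≤ K ∧ ∀ x, |deriv Real.smoothTransition x| ≤ K := by
  have hc : Continuous (deriv Real.smoothTransition) :=
    (Real.smoothTransition.contDiff (n := 1)).continuous_deriv le_rfl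
  obtain ⟨K, hK⟩ := (isCompact_Icc (a := (0 : ℝ)) (b := 1)).exists_bound_of_continuousOn
    hc.continuousOn
  refine ⟨K, (norm_nonneg _).trans (hK 0 (by simp)), fun x => ?_⟩
  rcases lt_or_ge x 0 with hx | hx
  · have : Real.smoothTransition =ᶠ[nhds x] fun _ => 0 := by
      filter_upwards [Iio_mem_nhds hx] with y hy
      exact Real.smoothTransition.zero_of_nonpos (le_of_lt hy)
    rw [this.deriv_eq]
    simpa using (norm_nonneg _).trans (hK 0 (by simp))
  rcases lt_or_ge 1 x with hx1 | hx1
  · have : Real.smoothTransition =ᶠ[nhds x] fun _ => 1 := by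
      filter_upwards [Ioi_mem_nhds hx1] with y hy
      exact Real.smoothTransition.one_of_one_le (le_of_lt hy)
    rw [this.deriv_eq]
    simpa using (norm_nonneg _).trans (hK 0 (by simp))
  · exact hK x ⟨hx, hx1⟩

/-- Smooth cutoffs on an interval whose derivatives blow up at most like the inverse distance to
the end points. -/
lemma exists_cutoff {a b : ℝ} (hab : a < b) :
    ∃ (η : ℕ → ℝ → ℝ) (K : ℝ), (∀ k, ContDiff ℝ (⊤ : ℕ∞) (η k)) ∧
      (∀ k, HasCompactSupport (η k)) ∧ (∀ k, tsupport (η k) ⊆ Set.Ioo a b) ∧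
      (∀ k t, |η k t| ≤ 1) ∧
      (∀ k, ∀ t ∈ Set.Ioo a b, (t - a) * (b - t) * |deriv (η k) t| ≤ K) ∧
      ∀ t ∈ Set.Ioo a b, ∀ᶠ k in Filter.atTop, η k t = 1 ∧ deriv (η k) t = 0 := by
  obtain ⟨K, hK0, hK⟩ := exists_bound_deriv_smoothTransition
  set r : ℝ → ℝ := fun t => (t - a) * (b - t) with hr
  -- The cutoff switches on where r lies between 1/(k + 1) and 2/(k + 1). Its slope there is of
  -- order k + 1, so r times the slope stays bounded uniformly in k.
  set z : ℕ → ℝ → ℝ := fun k t => (k + 1) * r t - 1 with hz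
  have hzc : ∀ k, Continuous (z k) := fun k => by simp only [hz, hr]; fun_prop
  have hone : ∀ k t, 1 < z k t → (fun t => Real.smoothTransition (z k t)) =ᶠ[nhds t]
      fun _ => 1 := fun k t h => by
    filter_upwards [(hzc k).continuousAt.eventually_mem (Ioi_mem_nhds h)] with y hy
    exact Real.smoothTransition.one_of_one_le (le_of_lt hy)
  have hsub : ∀ k, {t | 0 ≤ z k t} ⊆ Set.Ioo a b := fun k t (ht : 0 ≤ z k t) => by
    have h1 : 0 < (t - a) * (b - t) := by
      by_contra hc
      have : ((k : ℝ) + 1) * ((t - a) * (b - t)) ≤ 0 :=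
        mul_nonpos_of_nonneg_of_nonpos (by positivity) (not_lt.1 hc)
      simp only [hz, hr] at ht
      linarith
    rcases mul_pos_iff.1 h1 with h | h
    · exact ⟨by linarith, by linarith⟩
    · linarith
  have hts : ∀ k, tsupport (fun t => Real.smoothTransition (z k t)) ⊆ {t | 0 ≤ z k t} := by
    intro k
    refine closure_minimal (fun t ht => ?_) (isClosed_le continuous_const (hzc k))
    by_contra hc
    exact ht (Real.smoothTransition.zero_of_nonpos (not_le.1 hc).le)
  refine ⟨fun k t => Real.smoothTransition (z k t), 2 * K * (b - a), fun k => ?_, fun k => ?_,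
    fun k => (hts k).trans (hsub k), fun k t => ?_, fun k t ht => ?_, fun t ht => ?_⟩
  · refine Real.smoothTransition.contDiff.comp ?_
    simp only [hz, hr]; fun_prop
  · exact (isCompact_Icc (a := a) (b := b)).of_isClosed_subset (isClosed_tsupport _)
      (((hts k).trans (hsub k)).trans Set.Ioo_subset_Icc_self)
  · rw [abs_of_nonneg (Real.smoothTransition.nonneg _)]
    exact Real.smoothTransition.le_one _
  · have hrt : 0 ≤ r t := mul_nonneg (by linarith [ht.1]) (by linarith [ht.2])
    have hb : 0 ≤ b - a := by linarith
    rcases lt_or_ge 1 (z k t) with h | h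
    · rw [(hone k t h).deriv_eq]
      simp only [deriv_const, abs_zero, mul_zero]
      positivity
    · have hd : HasDerivAt (z k) ((k + 1) * (a + b - 2 * t)) t := by
        have h1 := (((hasDerivAt_id' t).sub_const a).mul
          ((hasDerivAt_id' t).const_sub b)).const_mul ((k : ℝ) + 1)
        exact HasDerivAt.congr_deriv (f := z k) (h1.sub_const 1) (by ring)
      have hs : HasDerivAt Real.smoothTransition (deriv Real.smoothTransition (z k t)) (z k t) :=
        ((Real.smoothTransition.contDiff (n := 1)).differentiable one_ne_zero _).hasDerivAt
      have hcomp := (hs.comp t hd).deriv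
      change deriv (fun t => Real.smoothTransition (z k t)) t = _ at hcomp
      rw [hcomp, abs_mul, abs_mul, abs_of_nonneg (by positivity : (0 : ℝ) ≤ k + 1)]
      have h2 : ((k : ℝ) + 1) * r t ≤ 2 := by simp only [hz] at h; linarith
      have h3 : |a + b - 2 * t| ≤ b - a := abs_le.2 ⟨by linarith [ht.2], by linarith [ht.1]⟩
      calc r t * (|deriv Real.smoothTransition (z k t)| * ((k + 1) * |a + b - 2 * t|))
          = ((k + 1) * r t) * |deriv Real.smoothTransition (z k t)| * |a + b - 2 * t| := by ring
        _ ≤ 2 * K * (b - a) := by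
          gcongr
          exact hK _
  · have hrt : 0 < r t := mul_pos (by linarith [ht.1]) (by linarith [ht.2])
    obtain ⟨N, hN⟩ := exists_nat_gt (2 / r t)
    filter_upwards [Filter.eventually_ge_atTop N] with k hk
    have h1 : 1 < z k t := by
      have : (N : ℝ) ≤ k := by exact_mod_cast hk
      have : 2 < (k + 1) * r t := by
        rw [← div_lt_iff₀ hrt]; linarith
      simp only [hz]; linarith
    exact ⟨Real.smoothTransition.one_of_one_le h1.le, by rw [(hone k t h1).deriv_eq]; simp⟩

/-! ### Weak gradients of product functions -/

/-- The projection of `ℝⁿ⁺¹` to the first `n` coordinates. -/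
noncomputable def headL (n : ℕ) : EuclideanSpace ℝ (Fin (n + 1)) →L[ℝ] EuclideanSpace ℝ (Fin n) :=
  (ContinuousLinearMap.fst ℝ _ _).comp (splitLast n).toContinuousLinearMap

/-- The projection of `ℝⁿ⁺¹` to the last coordinate. -/
noncomputable def lastL (n : ℕ) : EuclideanSpace ℝ (Fin (n + 1)) →L[ℝ] ℝ :=
  (ContinuousLinearMap.snd ℝ _ _).comp (splitLast n).toContinuousLinearMap

/-- The embedding of `ℝⁿ` into `ℝⁿ⁺¹` as the first `n` coordinates. -/
noncomputable def embHead (n : ℕ) :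
    EuclideanSpace ℝ (Fin n) →L[ℝ] EuclideanSpace ℝ (Fin (n + 1)) :=
  (splitLast n).symm.toContinuousLinearMap.comp (ContinuousLinearMap.inl ℝ _ _)

/-- The embedding of `ℝ` into `ℝⁿ⁺¹` as the last coordinate. -/
noncomputable def embLast (n : ℕ) : ℝ →L[ℝ] EuclideanSpace ℝ (Fin (n + 1)) :=
  (splitLast n).symm.toContinuousLinearMap.comp (ContinuousLinearMap.inr ℝ _ _)

lemma headL_apply {n : ℕ} (x : EuclideanSpace ℝ (Fin (n + 1))) :
    headL n x = (splitLast n x).1 := rfl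

lemma lastL_apply {n : ℕ} (x : EuclideanSpace ℝ (Fin (n + 1))) :
    lastL n x = (splitLast n x).2 := rfl

lemma inner_embHead {n : ℕ} (v : EuclideanSpace ℝ (Fin n)) (x : EuclideanSpace ℝ (Fin (n + 1))) :
    inner ℝ (embHead n v) x = inner ℝ v (headL n x) := by
  rw [inner_eq_splitLast]
  simp [embHead, headL]

lemma inner_embLast {n : ℕ} (τ : ℝ) (x : EuclideanSpace ℝ (Fin (n + 1))) :
    inner ℝ (embLast n τ) x = τ * lastL n x := by
  rw [inner_eq_splitLast]
  simp [embLast, lastL]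

section product

variable {n : ℕ} {D : Set (EuclideanSpace ℝ (Fin n))} {I : Set ℝ}

lemma memLp_prod_of_hasCompactSupport {F : EuclideanSpace ℝ (Fin n) × ℝ → ℝ} (hF : Continuous F)
    (hc : HasCompactSupport F) : MemLp F 2 ((volume.restrict D).prod (volume.restrict I)) := by
  rw [Measure.prod_restrict]
  exact (hF.memLp_of_hasCompactSupport hc).restrict _

lemma integral_eq_of_ae_splitLast {μ : Measure (EuclideanSpace ℝ (Fin n))} {ν : Measure ℝ}
    {ρ : Measure (EuclideanSpace ℝ (Fin (n + 1)))}
    (hp : MeasurePreserving (splitLast n) ρ (μ.prod ν)) {F : EuclideanSpace ℝ (Fin (n + 1)) → ℝ}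
    {A B : EuclideanSpace ℝ (Fin n) × ℝ → ℝ} (hA : Integrable A (μ.prod ν))
    (hB : Integrable B (μ.prod ν)) (r : ℝ)
    (hF : ∀ᵐ x ∂ρ, F x = A (splitLast n x) + r * B (splitLast n x)) :
    ∫ x, F x ∂ρ = ∫ z, A z ∂(μ.prod ν) + r * ∫ z, B z ∂(μ.prod ν) := by
  rw [integral_congr_ae hF, integral_splitLast hp fun z => A z + r * B z,
    integral_add hA (hB.const_mul r), integral_const_mul]

lemma hasFDerivAt_slice_left {ψ : EuclideanSpace ℝ (Fin n) × ℝ → ℝ}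
    (hψ : ContDiff ℝ (⊤ : ℕ∞) ψ) (y : EuclideanSpace ℝ (Fin n)) (t : ℝ) :
    HasFDerivAt (fun y => ψ (y, t))
      ((fderiv ℝ ψ (y, t)).comp (ContinuousLinearMap.inl ℝ _ _)) y :=
  ((hψ.differentiable (by simp) (y, t)).hasFDerivAt).comp y (hasFDerivAt_prodMk_left y t)

lemma hasDerivAt_slice_right {ψ : EuclideanSpace ℝ (Fin n) × ℝ → ℝ}
    (hψ : ContDiff ℝ (⊤ : ℕ∞) ψ) (y : EuclideanSpace ℝ (Fin n)) (t : ℝ) :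
    HasDerivAt (fun t => ψ (y, t)) (fderiv ℝ ψ (y, t) (0, 1)) t :=
  ((hψ.differentiable (by simp) (y, t)).hasFDerivAt).comp_hasDerivAt t
    ((hasDerivAt_const t y).prodMk (hasDerivAt_id t))

variable [IsFiniteMeasure (volume.restrict I)]

/-- For each fixed t the slice ψ(·, t) is an admissible test function on D, so the weak gradient of
u applies slice by slice. -/
lemma integral_prod_weak_head (hD : IsOpen D) {ψ : EuclideanSpace ℝ (Fin n) × ℝ → ℝ}
    (hψ : ContDiff ℝ (⊤ : ℕ∞) ψ) (hc : HasCompactSupport ψ) (hs : tsupport ψ ⊆ D ×ˢ I)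
    {u : Lp ℝ 2 (volume.restrict D)} {g : Lp (EuclideanSpace ℝ (Fin n)) 2 (volume.restrict D)}
    (hug : (u, g) ∈ sobolevH1 D) (c : ℝ →ᵇ ℝ) (v : EuclideanSpace ℝ (Fin n)) :
    ∫ z, (c z.2 • u z.1) * fderiv ℝ ψ z (v, 0) ∂((volume.restrict D).prod (volume.restrict I)) =
      -∫ z, (c z.2 • inner ℝ (g z.1) v) * ψ z
        ∂((volume.restrict D).prod (volume.restrict I)) := by
  have i1 : Integrable (fun z => (c z.2 • u z.1) * fderiv ℝ ψ z (v, 0))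
      ((volume.restrict D).prod (volume.restrict I)) :=
    (memLp_prod_smul c (Lp.memLp u)).integrable_mul (memLp_prod_of_hasCompactSupport
      ((hψ.continuous_fderiv (by simp)).clm_apply continuous_const) (hc.fderiv_apply ℝ _))
  have i2 : Integrable (fun z => (c z.2 • inner ℝ (g z.1) v) * ψ z)
      ((volume.restrict D).prod (volume.restrict I)) :=
    (memLp_prod_smul (u := fun y => (inner ℝ (g y) v : ℝ)) c ((Lp.memLp g).inner_const v)).integrable_mul
      (memLp_prod_of_hasCompactSupport hψ.continuous hc)
  rw [integral_prod_symm _ i1, integral_prod_symm _ i2, ← integral_neg]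
  refine integral_congr_ae (Filter.Eventually.of_forall fun t => ?_)
  have hemb : Topology.IsClosedEmbedding (fun y : EuclideanSpace ℝ (Fin n) => (y, t)) :=
    Topology.IsClosedEmbedding.of_continuous_injective_isClosedMap (by fun_prop)
      (fun _ _ h => (Prod.mk.inj h).1) fun S hS => by
        have : (fun y : EuclideanSpace ℝ (Fin n) => (y, t)) '' S = S ×ˢ {t} := by
          ext z; constructor
          · rintro ⟨y, hy, rfl⟩; exact ⟨hy, rfl⟩
          · rintro ⟨h1, h2⟩; exact ⟨z.1, h1, Prod.ext rfl h2.symm⟩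
        rw [this]
        exact hS.prod isClosed_singleton
  have h := hug (fun y => ψ (y, t)) (hψ.comp (by fun_prop)) (hc.comp_isClosedEmbedding hemb)
    (by
      rw [hD.interior_eq]
      intro y hy
      exact (hs (tsupport_comp_subset_preimage ψ (f := fun y => (y, t)) (by fun_prop) hy)).1) v
  have e : ∀ y, fderiv ℝ (fun y => ψ (y, t)) y v = fderiv ℝ ψ (y, t) (v, 0) := fun y => by
    rw [(hasFDerivAt_slice_left hψ y t).fderiv]; rfl
  simp only [e] at h
  simp only [smul_eq_mul, mul_assoc, integral_const_mul]
  rw [h]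
  ring

/-- For fixed y, ψ(y, ·) has compact support inside I. The integral extends to the whole line, where
integration by parts has no boundary terms for any κ. -/
lemma integral_prod_weak_last {ψ : EuclideanSpace ℝ (Fin n) × ℝ → ℝ}
    (hψ : ContDiff ℝ (⊤ : ℕ∞) ψ) (hc : HasCompactSupport ψ) (hs : tsupport ψ ⊆ D ×ˢ I)
    (u : Lp ℝ 2 (volume.restrict D)) (κ a : ℝ) :
    ∫ z, (cosB κ a z.2 • u z.1) * fderiv ℝ ψ z (0, 1)
        ∂((volume.restrict D).prod (volume.restrict I)) =
      κ * ∫ z, (sinB κ a z.2 • u z.1) * ψ z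
        ∂((volume.restrict D).prod (volume.restrict I)) := by
  have i1 : Integrable (fun z => (cosB κ a z.2 • u z.1) * fderiv ℝ ψ z (0, 1))
      ((volume.restrict D).prod (volume.restrict I)) :=
    (memLp_prod_smul _ (Lp.memLp u)).integrable_mul (memLp_prod_of_hasCompactSupport
      ((hψ.continuous_fderiv (by simp)).clm_apply continuous_const) (hc.fderiv_apply ℝ _))
  have i2 : Integrable (fun z => (sinB κ a z.2 • u z.1) * ψ z)
      ((volume.restrict D).prod (volume.restrict I)) :=
    (memLp_prod_smul _ (Lp.memLp u)).integrable_mul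
      (memLp_prod_of_hasCompactSupport hψ.continuous hc)
  rw [integral_prod _ i1, integral_prod _ i2, ← integral_const_mul]
  refine integral_congr_ae (Filter.Eventually.of_forall fun y => ?_)
  have hemb : Topology.IsClosedEmbedding (fun t : ℝ => (y, t)) :=
    Topology.IsClosedEmbedding.of_continuous_injective_isClosedMap (by fun_prop)
      (fun _ _ h => (Prod.mk.inj h).2) fun S hS => by
        have : (fun t : ℝ => (y, t)) '' S = {y} ×ˢ S := by
          ext z; constructor
          · rintro ⟨y, hy, rfl⟩; exact ⟨rfl, hy⟩
          · rintro ⟨h1, h2⟩; exact ⟨z.2, h2, Prod.ext h1.symm rfl⟩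
        rw [this]
        exact isClosed_singleton.prod hS
  have hnot : ∀ t, t ∉ I → (y, t) ∉ tsupport ψ := fun t ht h => ht (hs h).2
  have hχc : HasCompactSupport fun t => ψ (y, t) := hc.comp_isClosedEmbedding hemb
  have hχ : Continuous fun t => ψ (y, t) := hψ.continuous.comp (by fun_prop)
  have hχ'c : HasCompactSupport fun t => fderiv ℝ ψ (y, t) (0, 1) :=
    (hc.fderiv_apply ℝ (0, 1)).comp_isClosedEmbedding hemb
  have hχ' : Continuous fun t => fderiv ℝ ψ (y, t) (0, 1) :=
    ((hψ.continuous_fderiv (by simp)).clm_apply continuous_const).comp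
      (by fun_prop : Continuous fun t : ℝ => (y, t))
  have hparts := integral_mul_deriv_eq_deriv_mul_of_integrable (u := cosB κ a)
    (v := fun t => ψ (y, t)) (fun t _ => hasDerivAt_cosB κ a t)
    (fun t _ => hasDerivAt_slice_right hψ y t)
    (((cosB κ a).continuous.mul hχ').integrable_of_hasCompactSupport hχ'c.mul_left)
    (((continuous_const.mul (sinB κ a).continuous).mul hχ).integrable_of_hasCompactSupport
      hχc.mul_left)
    (((cosB κ a).continuous.mul hχ).integrable_of_hasCompactSupport hχc.mul_left)
  have e1 : ∫ t in I, cosB κ a t * fderiv ℝ ψ (y, t) (0, 1) =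
      ∫ t, cosB κ a t * fderiv ℝ ψ (y, t) (0, 1) :=
    setIntegral_eq_integral_of_forall_compl_eq_zero fun t ht => by
      rw [fderiv_of_notMem_tsupport ℝ (hnot t ht)]; simp
  have e2 : ∫ t in I, sinB κ a t * ψ (y, t) = ∫ t, sinB κ a t * ψ (y, t) :=
    setIntegral_eq_integral_of_forall_compl_eq_zero fun t ht => by
      rw [image_eq_zero_of_notMem_tsupport (hnot t ht), mul_zero]
  calc ∫ t in I, (cosB κ a t • u y) * fderiv ℝ ψ (y, t) (0, 1)
      = u y * ∫ t in I, cosB κ a t * fderiv ℝ ψ (y, t) (0, 1) := by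
        rw [← integral_const_mul]
        congr 1 with t
        rw [smul_eq_mul]; ring
    _ = u y * (κ * ∫ t in I, sinB κ a t * ψ (y, t)) := by
        rw [e1, e2, hparts, ← integral_neg, ← integral_const_mul κ]
        congr 2 with t
        ring
    _ = κ * ∫ t in I, (sinB κ a t • u y) * ψ (y, t) := by
        rw [mul_left_comm, ← integral_const_mul (u y)]
        congr 2 with t
        rw [smul_eq_mul]; ring

variable (hp : MeasurePreserving (splitLast n) (volume.restrict (productDomain D I))
  ((volume.restrict D).prod (volume.restrict I)))

/-- The map `(u, ∇u) ↦ (u ⊗ c, ∇(u ⊗ c))` for `c(t) = cos (κ (t - a))`. -/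
noncomputable def liftPair (κ a : ℝ) :
    Lp ℝ 2 (volume.restrict D) × Lp (EuclideanSpace ℝ (Fin n)) 2 (volume.restrict D) →ₗ[ℝ]
    Lp ℝ 2 (volume.restrict (productDomain D I)) ×
      Lp (EuclideanSpace ℝ (Fin (n + 1))) 2 (volume.restrict (productDomain D I)) :=
  (((lift hp (cosB κ a)).comp (ContinuousLinearMap.fst ℝ _ _)).prod
    (((embHead n).compLpL 2 _).comp
        ((lift hp (cosB κ a)).comp (ContinuousLinearMap.snd ℝ _ _)) -
      κ • ((embLast n).compLpL 2 _).comp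
        ((lift hp (sinB κ a)).comp (ContinuousLinearMap.fst ℝ _ _)))).toLinearMap

lemma liftPair_fst (κ a : ℝ)
    (p : Lp ℝ 2 (volume.restrict D) × Lp (EuclideanSpace ℝ (Fin n)) 2 (volume.restrict D)) :
    (liftPair hp κ a p).1 = lift hp (cosB κ a) p.1 := rfl

lemma liftPair_snd (κ a : ℝ)
    (p : Lp ℝ 2 (volume.restrict D) × Lp (EuclideanSpace ℝ (Fin n)) 2 (volume.restrict D)) :
    (liftPair hp κ a p).2 = (embHead n).compLpL 2 _ (lift hp (cosB κ a) p.2) -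
      κ • (embLast n).compLpL 2 _ (lift hp (sinB κ a) p.1) := rfl

lemma inner_compLpL_embHead {ρ : Measure (EuclideanSpace ℝ (Fin (n + 1)))}
    (g : Lp (EuclideanSpace ℝ (Fin n)) 2 ρ) (h : Lp (EuclideanSpace ℝ (Fin (n + 1))) 2 ρ) :
    inner ℝ ((embHead n).compLpL 2 ρ g) h = inner ℝ g ((headL n).compLpL 2 ρ h) := by
  rw [L2.inner_def, L2.inner_def]
  refine integral_congr_ae ?_
  filter_upwards [(embHead n).coeFn_compLpL (p := 2) g, (headL n).coeFn_compLpL (p := 2) h]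
    with x h1 h2
  rw [h1, h2, inner_embHead]

lemma inner_compLpL_embLast {ρ : Measure (EuclideanSpace ℝ (Fin (n + 1)))}
    (g : Lp ℝ 2 ρ) (h : Lp (EuclideanSpace ℝ (Fin (n + 1))) 2 ρ) :
    inner ℝ ((embLast n).compLpL 2 ρ g) h = inner ℝ g ((lastL n).compLpL 2 ρ h) := by
  rw [L2.inner_def, L2.inner_def]
  refine integral_congr_ae ?_
  filter_upwards [(embLast n).coeFn_compLpL (p := 2) g, (lastL n).coeFn_compLpL (p := 2) h]
    with x h1 h2
  rw [h1, h2, inner_embLast]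
  simp [mul_comm]

lemma coeFn_liftPair_snd (κ a : ℝ)
    (p : Lp ℝ 2 (volume.restrict D) × Lp (EuclideanSpace ℝ (Fin n)) 2 (volume.restrict D)) :
    (liftPair hp κ a p).2 =ᵐ[volume.restrict (productDomain D I)] fun x =>
      embHead n (cosB κ a (splitLast n x).2 • p.2 (splitLast n x).1) -
        κ • embLast n (sinB κ a (splitLast n x).2 • p.1 (splitLast n x).1) := by
  rw [liftPair_snd]
  filter_upwards [Lp.coeFn_sub ((embHead n).compLpL 2 _ (lift hp (cosB κ a) p.2))
      (κ • (embLast n).compLpL 2 _ (lift hp (sinB κ a) p.1)),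
    Lp.coeFn_smul κ ((embLast n).compLpL 2 _ (lift hp (sinB κ a) p.1)),
    (embHead n).coeFn_compLpL (p := 2) (lift hp (cosB κ a) p.2),
    (embLast n).coeFn_compLpL (p := 2) (lift hp (sinB κ a) p.1),
    coeFn_lift hp (cosB κ a) p.2, coeFn_lift hp (sinB κ a) p.1] with x h1 h2 h3 h4 h5 h6
  rw [h1, Pi.sub_apply, h2, Pi.smul_apply, h3, h4, h5, h6]

lemma liftPair_mem_sobolevH1 (hD : IsOpen D) (κ a : ℝ)
    {p : Lp ℝ 2 (volume.restrict D) × Lp (EuclideanSpace ℝ (Fin n)) 2 (volume.restrict D)}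
    (hpD : p ∈ sobolevH1 D) : liftPair hp κ a p ∈ sobolevH1 (productDomain D I) := by
  intro φ hφ hc hs v
  obtain ⟨u, g⟩ := p
  set ψ : EuclideanSpace ℝ (Fin n) × ℝ → ℝ := fun z => φ ((splitLast n).symm z) with hψdef
  have hφψ : φ = ψ ∘ splitLast n := by ext x; simp [hψdef]
  have hψ : ContDiff ℝ (⊤ : ℕ∞) ψ := hφ.comp (splitLast n).symm.contDiff
  have hψc : HasCompactSupport ψ :=
    hc.comp_isClosedEmbedding (splitLast n).symm.toHomeomorph.isClosedEmbedding
  have hψs : tsupport ψ ⊆ D ×ˢ I := by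
    intro z hz
    have h1 := interior_subset (hs (tsupport_comp_subset_preimage φ
      (splitLast n).symm.continuous hz))
    rw [productDomain_eq_preimage, Set.mem_preimage] at h1
    simpa using h1
  have hfd : ∀ x, fderiv ℝ φ x v = fderiv ℝ ψ (splitLast n x) ((splitLast n v).1, 0)
      + (splitLast n v).2 * fderiv ℝ ψ (splitLast n x) (0, 1) := by
    intro x
    rw [hφψ, (splitLast n).comp_right_fderiv]
    change fderiv ℝ ψ (splitLast n x) (splitLast n v) = _
    rw [← smul_eq_mul, ← map_smul, ← map_add]
    congr 1
    ext <;> simp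
  have hm1 : ∀ w : EuclideanSpace ℝ (Fin n) × ℝ, MemLp (fun z => fderiv ℝ ψ z w) 2
      ((volume.restrict D).prod (volume.restrict I)) := fun w =>
    memLp_prod_of_hasCompactSupport ((hψ.continuous_fderiv (by simp)).clm_apply continuous_const)
      (hψc.fderiv_apply ℝ _)
  have hm2 : MemLp ψ 2 ((volume.restrict D).prod (volume.restrict I)) :=
    memLp_prod_of_hasCompactSupport hψ.continuous hψc
  have hL : ∫ x in productDomain D I, (liftPair hp κ a (u, g)).1 x * fderiv ℝ φ x v =
      ∫ z, (cosB κ a z.2 • u z.1) * fderiv ℝ ψ z ((splitLast n v).1, 0)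
          ∂((volume.restrict D).prod (volume.restrict I)) +
        (splitLast n v).2 * ∫ z, (cosB κ a z.2 • u z.1) * fderiv ℝ ψ z (0, 1)
          ∂((volume.restrict D).prod (volume.restrict I)) := by
    have i1 : Integrable (fun z => (cosB κ a z.2 • u z.1) * fderiv ℝ ψ z ((splitLast n v).1, 0))
        ((volume.restrict D).prod (volume.restrict I)) :=
      (memLp_prod_smul (cosB κ a) (Lp.memLp u)).integrable_mul (hm1 _)
    have i2 : Integrable (fun z => (cosB κ a z.2 • u z.1) * fderiv ℝ ψ z (0, 1))
        ((volume.restrict D).prod (volume.restrict I)) :=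
      (memLp_prod_smul (cosB κ a) (Lp.memLp u)).integrable_mul (hm1 _)
    refine integral_eq_of_ae_splitLast hp i1 i2 _ ?_
    filter_upwards [coeFn_lift hp (cosB κ a) u] with x hx
    rw [liftPair_fst, hx, hfd]
    ring
  have hR : ∫ x in productDomain D I, inner ℝ ((liftPair hp κ a (u, g)).2 x) v * φ x =
      ∫ z, (cosB κ a z.2 • inner ℝ (g z.1) (splitLast n v).1) * ψ z
          ∂((volume.restrict D).prod (volume.restrict I)) +
        (-((splitLast n v).2 * κ)) * ∫ z, (sinB κ a z.2 • u z.1) * ψ z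
          ∂((volume.restrict D).prod (volume.restrict I)) := by
    have i1 : Integrable (fun z => (cosB κ a z.2 • inner ℝ (g z.1) (splitLast n v).1) * ψ z)
        ((volume.restrict D).prod (volume.restrict I)) :=
      (memLp_prod_smul (u := fun y => (inner ℝ (g y) (splitLast n v).1 : ℝ)) (cosB κ a)
        ((Lp.memLp g).inner_const _)).integrable_mul hm2
    have i2 : Integrable (fun z => (sinB κ a z.2 • u z.1) * ψ z)
        ((volume.restrict D).prod (volume.restrict I)) :=
      (memLp_prod_smul (sinB κ a) (Lp.memLp u)).integrable_mul hm2
    refine integral_eq_of_ae_splitLast hp i1 i2 _ ?_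
    filter_upwards [coeFn_liftPair_snd hp κ a (u, g)] with x hx
    rw [hx, inner_sub_left, real_inner_smul_left, inner_embHead, inner_embLast,
      real_inner_smul_left, headL_apply, lastL_apply, hφψ, Function.comp_apply]
    simp only [smul_eq_mul]
    ring
  rw [hL, hR, integral_prod_weak_head hD hψ hψc hψs hpD,
    integral_prod_weak_last hψ hψc hψs]
  ring

end product

/-! ### Test functions that reach the ends of the interval -/

lemma tendsto_integral_mul_of_bounded {α : Type*} [MeasurableSpace α] {ρ : Measure α}
    {f : α → ℝ} (hf : Integrable f ρ) {F : ℕ → α → ℝ} {G : α → ℝ} (K : ℝ)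
    (hF : ∀ k, AEStronglyMeasurable (F k) ρ) (hK : ∀ k, ∀ᵐ x ∂ρ, |F k x| ≤ K)
    (hlim : ∀ᵐ x ∂ρ, Filter.Tendsto (fun k => F k x) Filter.atTop (nhds (G x))) :
    Filter.Tendsto (fun k => ∫ x, f x * F k x ∂ρ) Filter.atTop (nhds (∫ x, f x * G x ∂ρ)) := by
  refine tendsto_integral_of_dominated_convergence (fun x => |f x| * K)
    (fun k => hf.aestronglyMeasurable.mul (hF k)) (hf.abs.mul_const K) (fun k => ?_) ?_
  · filter_upwards [hK k] with x hx
    rw [Real.norm_eq_abs, abs_mul]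
    gcongr
  · filter_upwards [hlim] with x hx
    exact hx.const_mul _

lemma exists_abs_le_of_hasCompactSupport {E : Type*} [TopologicalSpace E] {f : E → ℝ}
    (hf : Continuous f) (hc : HasCompactSupport f) : ∃ K, 0 ≤ K ∧ ∀ x, |f x| ≤ K := by
  obtain ⟨K, hK⟩ := hf.bounded_above_of_compact_support hc
  exact ⟨max K 0, le_max_right _ _, fun x => (hK x).trans (le_max_left _ _)⟩

section test

variable {n : ℕ} {D : Set (EuclideanSpace ℝ (Fin n))} {I : Set ℝ} {a b : ℝ}

lemma integral_tensor_test (hD : IsOpen D) (hI : Set.Ioo a b ⊆ I)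
    {q : Lp ℝ 2 (volume.restrict (productDomain D I)) ×
      Lp (EuclideanSpace ℝ (Fin (n + 1))) 2 (volume.restrict (productDomain D I))}
    (hq : q ∈ sobolevH1 (productDomain D I))
    {φ : EuclideanSpace ℝ (Fin n) → ℝ} (hφ : ContDiff ℝ (⊤ : ℕ∞) φ) (hφc : HasCompactSupport φ)
    (hφs : tsupport φ ⊆ D) {σ : ℝ → ℝ} (hσ : ContDiff ℝ (⊤ : ℕ∞) σ) (hσc : HasCompactSupport σ)
    (hσs : tsupport σ ⊆ Set.Ioo a b) (v : EuclideanSpace ℝ (Fin n)) (τ : ℝ) :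
    ∫ x in productDomain D I, q.1 x * (φ (splitLast n x).1 * (τ * deriv σ (splitLast n x).2) +
        σ (splitLast n x).2 * fderiv ℝ φ (splitLast n x).1 v) =
      -∫ x in productDomain D I, (inner ℝ (headL n (q.2 x)) v + lastL n (q.2 x) * τ) *
        (φ (splitLast n x).1 * σ (splitLast n x).2) := by
  have hsub : tsupport (fun x => φ (splitLast n x).1 * σ (splitLast n x).2) ⊆
      splitLast n ⁻¹' (tsupport φ ×ˢ tsupport σ) := by
    refine closure_minimal (fun x hx => ?_)
      (((isClosed_tsupport φ).prod (isClosed_tsupport σ)).preimage (splitLast n).continuous)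
    have hx' : φ (splitLast n x).1 * σ (splitLast n x).2 ≠ 0 := hx
    exact ⟨subset_tsupport _ (left_ne_zero_of_mul hx'),
      subset_tsupport _ (right_ne_zero_of_mul hx')⟩
  have hcpt : HasCompactSupport fun x => φ (splitLast n x).1 * σ (splitLast n x).2 := by
    refine IsCompact.of_isClosed_subset ?_ (isClosed_tsupport _) hsub
    exact (splitLast n).toHomeomorph.isCompact_preimage.2 (hφc.isCompact.prod hσc.isCompact)
  have hint : splitLast n ⁻¹' (tsupport φ ×ˢ tsupport σ) ⊆ interior (productDomain D I) := by
    have h1 : splitLast n ⁻¹' (D ×ˢ Set.Ioo a b) ⊆ interior (productDomain D I) :=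
      interior_maximal (fun x hx => ⟨hx.1, hI hx.2⟩)
        ((hD.prod isOpen_Ioo).preimage (splitLast n).continuous)
    exact fun x hx => h1 ⟨hφs hx.1, hσs hx.2⟩
  have hsm : ContDiff ℝ (⊤ : ℕ∞) fun x => φ (splitLast n x).1 * σ (splitLast n x).2 :=
    (hφ.comp (contDiff_fst.comp (splitLast n).contDiff)).mul
      (hσ.comp (contDiff_snd.comp (splitLast n).contDiff))
  have h := hq _ hsm hcpt (hsub.trans hint) (embHead n v + embLast n τ)
  have hfd : ∀ x, fderiv ℝ (fun x => φ (splitLast n x).1 * σ (splitLast n x).2) x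
      (embHead n v + embLast n τ) = φ (splitLast n x).1 * (τ * deriv σ (splitLast n x).2) +
        σ (splitLast n x).2 * fderiv ℝ φ (splitLast n x).1 v := by
    intro x
    have h1 : HasFDerivAt (fun x => φ (splitLast n x).1)
        ((fderiv ℝ φ (headL n x)).comp (headL n)) x :=
      ((hφ.differentiable (by simp) (headL n x)).hasFDerivAt).comp x (headL n).hasFDerivAt
    have h2 : HasFDerivAt (fun x => σ (splitLast n x).2)
        ((fderiv ℝ σ (lastL n x)).comp (lastL n)) x :=
      ((hσ.differentiable (by simp) (lastL n x)).hasFDerivAt).comp x (lastL n).hasFDerivAt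
    have h3 : HasFDerivAt (fun x => φ (splitLast n x).1 * σ (splitLast n x).2) _ x := h1.mul h2
    rw [h3.fderiv]
    simp [headL, lastL, embHead, embLast]
  have hin : ∀ x, inner ℝ (q.2 x) (embHead n v + embLast n τ) =
      inner ℝ (headL n (q.2 x)) v + lastL n (q.2 x) * τ := by
    intro x
    rw [real_inner_comm, inner_add_left, inner_embHead, inner_embLast, real_inner_comm, mul_comm]
  simp only [hfd, hin] at h
  exact h

lemma ae_splitLast_snd_mem_Ioo
    (hp : MeasurePreserving (splitLast n) (volume.restrict (productDomain D I))
      ((volume.restrict D).prod (volume.restrict I)))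
    (hIm : MeasurableSet I) (hI' : I ⊆ Set.Icc a b) :
    ∀ᵐ x ∂(volume.restrict (productDomain D I)), (splitLast n x).2 ∈ Set.Ioo a b := by
  refine ae_comp_splitLast_snd hp ?_
  have h1 : ∀ᵐ t : ℝ, t ≠ a ∧ t ≠ b := by
    filter_upwards [Measure.ae_ne volume a, Measure.ae_ne volume b] with t h1 h2
    exact ⟨h1, h2⟩
  filter_upwards [ae_restrict_mem hIm, ae_restrict_of_ae h1] with t h2 h3
  exact ⟨lt_of_le_of_ne (hI' h2).1 h3.1.symm, lt_of_le_of_ne (hI' h2).2 h3.2⟩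

lemma isFiniteMeasure_of_splitLast {μ : Measure (EuclideanSpace ℝ (Fin n))} {ν : Measure ℝ}
    [IsFiniteMeasure μ] [IsFiniteMeasure ν] {ρ : Measure (EuclideanSpace ℝ (Fin (n + 1)))}
    (hp : MeasurePreserving (splitLast n) ρ (μ.prod ν)) : IsFiniteMeasure ρ :=
  ⟨by
    have := hp.measure_preimage MeasurableSet.univ.nullMeasurableSet
    rw [Set.preimage_univ] at this
    rw [this]
    exact measure_lt_top _ _⟩

/-- The function φ(y)s(t) need not be compactly supported in the product, so s is replaced by sη_k
with the cutoffs η_k and dominated convergence is applied. The dangerous term τ s η_k' is bounded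
because τs is at most C(t - a)(b - t). For τ = 0, differentiation along D, this is no condition on
s; for τ = 1 it makes s vanish at the ends. -/
lemma integral_tensor_test_of_bound [IsFiniteMeasure (volume.restrict D)]
    [IsFiniteMeasure (volume.restrict I)]
    (hp : MeasurePreserving (splitLast n) (volume.restrict (productDomain D I))
      ((volume.restrict D).prod (volume.restrict I)))
    (hD : IsOpen D) (hab : a < b) (hI : Set.Ioo a b ⊆ I) (hIm : MeasurableSet I)
    (hI' : I ⊆ Set.Icc a b)
    {q : Lp ℝ 2 (volume.restrict (productDomain D I)) ×
      Lp (EuclideanSpace ℝ (Fin (n + 1))) 2 (volume.restrict (productDomain D I))}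
    (hq : q ∈ sobolevH1 (productDomain D I))
    {φ : EuclideanSpace ℝ (Fin n) → ℝ} (hφ : ContDiff ℝ (⊤ : ℕ∞) φ) (hφc : HasCompactSupport φ)
    (hφs : tsupport φ ⊆ D) {s : ℝ → ℝ} (hs : ContDiff ℝ (⊤ : ℕ∞) s) {S S' C τ : ℝ}
    (hS : ∀ t, |s t| ≤ S) (hS' : ∀ t, |τ * deriv s t| ≤ S') (hC0 : 0 ≤ C)
    (hC : ∀ t ∈ Set.Ioo a b, |τ * s t| ≤ C * ((t - a) * (b - t)))
    (v : EuclideanSpace ℝ (Fin n)) :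
    ∫ x in productDomain D I, q.1 x * (φ (splitLast n x).1 * (τ * deriv s (splitLast n x).2) +
        s (splitLast n x).2 * fderiv ℝ φ (splitLast n x).1 v) =
      -∫ x in productDomain D I, (inner ℝ (headL n (q.2 x)) v + lastL n (q.2 x) * τ) *
        (φ (splitLast n x).1 * s (splitLast n x).2) := by
  have hfin := isFiniteMeasure_of_splitLast hp
  obtain ⟨η, K, hη, hηc, hηs, hη1, hηK, hηlim⟩ := exists_cutoff hab
  have hdφ : Continuous fun y => fderiv ℝ φ y v :=
    (hφ.continuous_fderiv (by simp)).clm_apply continuous_const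
  obtain ⟨P, hP0, hP⟩ := exists_abs_le_of_hasCompactSupport hφ.continuous hφc
  obtain ⟨P', hP'0, hP'⟩ := exists_abs_le_of_hasCompactSupport hdφ (hφc.fderiv_apply ℝ v)
  have hmem := ae_splitLast_snd_mem_Ioo hp hIm hI'
  have hS0 : 0 ≤ S := (abs_nonneg _).trans (hS 0)
  have hσ : ∀ k, ContDiff ℝ (⊤ : ℕ∞) fun t => s t * η k t := fun k => hs.mul (hη k)
  have hd : ∀ k t, deriv (fun t => s t * η k t) t = deriv s t * η k t + s t * deriv (η k) t :=
    fun k t => ((hs.differentiable (by simp) t).hasDerivAt.mul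
      ((hη k).differentiable (by simp) t).hasDerivAt).deriv
  have hdc : ∀ k, Continuous (deriv fun t => s t * η k t) := fun k =>
    (hσ k).continuous_deriv (by simp)
  have hsb : ∀ k t, |s t * η k t| ≤ S := fun k t => by
    rw [abs_mul]
    calc |s t| * |η k t| ≤ S * 1 := by gcongr; exacts [hS t, hη1 k t]
      _ = S := mul_one S
  have hdb : ∀ k, ∀ t ∈ Set.Ioo a b, |τ * deriv (fun t => s t * η k t) t| ≤ S' + C * K := by
    intro k t ht
    have e : τ * deriv (fun t => s t * η k t) t =
        (τ * deriv s t) * η k t + (τ * s t) * deriv (η k) t := by rw [hd]; ring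
    rw [e]
    refine (abs_add_le _ _).trans (add_le_add ?_ ?_)
    · rw [abs_mul]
      calc |τ * deriv s t| * |η k t| ≤ |τ * deriv s t| * 1 := by gcongr; exact hη1 k t
        _ ≤ S' := by rw [mul_one]; exact hS' t
    · rw [abs_mul]
      calc |τ * s t| * |deriv (η k) t| ≤ C * ((t - a) * (b - t)) * |deriv (η k) t| := by
            gcongr; exact hC t ht
        _ = C * ((t - a) * (b - t) * |deriv (η k) t|) := by ring
        _ ≤ C * K := by gcongr; exact hηK k t ht
  have hcfst : Continuous fun x : EuclideanSpace ℝ (Fin (n + 1)) => (splitLast n x).1 :=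
    (headL n).continuous
  have hcsnd : Continuous fun x : EuclideanSpace ℝ (Fin (n + 1)) => (splitLast n x).2 :=
    (lastL n).continuous
  have i1 : Integrable (fun x => q.1 x) (volume.restrict (productDomain D I)) :=
    (Lp.memLp q.1).integrable (by norm_num)
  have i2 : Integrable (fun x => inner ℝ (headL n (q.2 x)) v + lastL n (q.2 x) * τ)
      (volume.restrict (productDomain D I)) := by
    have i3 : Integrable (fun x => q.2 x) (volume.restrict (productDomain D I)) :=
      (Lp.memLp q.2).integrable (by norm_num)
    exact (((headL n).integrable_comp i3).inner_const v).add
      (((lastL n).integrable_comp i3).mul_const τ)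
  have l1 := tendsto_integral_mul_of_bounded i1
    (F := fun k x => φ (splitLast n x).1 * (τ * deriv (fun t => s t * η k t) (splitLast n x).2) +
        (s (splitLast n x).2 * η k (splitLast n x).2) * fderiv ℝ φ (splitLast n x).1 v)
    (G := fun x => φ (splitLast n x).1 * (τ * deriv s (splitLast n x).2) +
        s (splitLast n x).2 * fderiv ℝ φ (splitLast n x).1 v)
    (P * (S' + C * K) + S * P')
    (fun k => (((hφ.continuous.comp hcfst).mul (continuous_const.mul ((hdc k).comp hcsnd))).add
      (((hσ k).continuous.comp hcsnd).mul (hdφ.comp hcfst))).aestronglyMeasurable)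
    (fun k => by
      filter_upwards [hmem] with x hx
      refine (abs_add_le _ _).trans (add_le_add ?_ ?_)
      · rw [abs_mul]; gcongr; exacts [hP _, hdb k _ hx]
      · rw [abs_mul]; gcongr; exacts [hsb k _, hP' _])
    (by
      filter_upwards [hmem] with x hx
      refine tendsto_const_nhds.congr' ?_
      filter_upwards [hηlim _ hx] with k hk
      rw [hd, hk.1, hk.2]
      simp)
  have l2 := tendsto_integral_mul_of_bounded i2
    (F := fun k x => φ (splitLast n x).1 * (s (splitLast n x).2 * η k (splitLast n x).2))
    (G := fun x => φ (splitLast n x).1 * s (splitLast n x).2) (P * S)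
    (fun k => ((hφ.continuous.comp hcfst).mul
      ((hσ k).continuous.comp hcsnd)).aestronglyMeasurable)
    (fun k => Filter.Eventually.of_forall fun x => by
      rw [abs_mul]; gcongr; exacts [hP _, hsb k _])
    (by
      filter_upwards [hmem] with x hx
      refine tendsto_const_nhds.congr' ?_
      filter_upwards [hηlim _ hx] with k hk
      rw [hk.1, mul_one])
  refine tendsto_nhds_unique l1 (l2.neg.congr fun k => ?_)
  refine (integral_tensor_test hD hI hq hφ hφc hφs (hσ k) (hηc k).mul_left ?_ v τ).symm
  exact (tsupport_mul_subset_right).trans (hηs k)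

end test

/-! ### Product functions are Neumann eigenfunctions -/

lemma integral_inner_smul_const {X α : Type*} [NormedAddCommGroup X] [InnerProductSpace ℝ X]
    [MeasurableSpace α] (ρ : Measure α) (φ : α → ℝ) (v : X) (G : α → X) :
    ∫ y, inner ℝ (φ y • v) (G y) ∂ρ = ∫ y, inner ℝ (G y) v * φ y ∂ρ := by
  refine integral_congr_ae (Filter.Eventually.of_forall fun y => ?_)
  simp only
  rw [real_inner_smul_left, real_inner_comm, mul_comm]

lemma integral_inner_real {α : Type*} [MeasurableSpace α] (ρ : Measure α) (φ G : α → ℝ) :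
    ∫ y, inner ℝ (φ y) (G y) ∂ρ = ∫ y, G y * φ y ∂ρ := rfl

lemma Lp_add_smul_eq_zero_of_forall_test {n : ℕ} {D : Set (EuclideanSpace ℝ (Fin n))}
    (hD : IsOpen D) [IsFiniteMeasure (volume.restrict D)] (F₁ F₂ : Lp ℝ 2 (volume.restrict D))
    (κ : ℝ)
    (h : ∀ φ : EuclideanSpace ℝ (Fin n) → ℝ, ContDiff ℝ (⊤ : ℕ∞) φ → HasCompactSupport φ →
      tsupport φ ⊆ D → (∫ y in D, F₁ y * φ y) + κ * ∫ y in D, F₂ y * φ y = 0) :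
    F₁ + κ • F₂ = 0 := by
  have hloc : LocallyIntegrableOn (fun y => F₁ y + κ * F₂ y) D (volume.restrict D) :=
    (((Lp.memLp F₁).integrable (by norm_num)).add
      (((Lp.memLp F₂).integrable (by norm_num)).const_mul κ)).locallyIntegrable
        |>.locallyIntegrableOn D
  have hz := hD.ae_eq_zero_of_integral_contDiff_smul_eq_zero hloc fun φ hφ hc hs => by
    have hφ2 : MemLp φ 2 (volume.restrict D) :=
      (hφ.continuous.memLp_of_hasCompactSupport hc).restrict D
    have i1 : Integrable (fun y => F₁ y * φ y) (volume.restrict D) :=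
      (Lp.memLp F₁).integrable_mul hφ2
    have i2 : Integrable (fun y => F₂ y * φ y) (volume.restrict D) :=
      (Lp.memLp F₂).integrable_mul hφ2
    rw [← h φ hφ hc hs, ← integral_const_mul, ← integral_add i1 (i2.const_mul κ)]
    refine integral_congr_ae (Filter.Eventually.of_forall fun y => ?_)
    simp only [smul_eq_mul]
    ring
  rw [Lp.eq_zero_iff_ae_eq_zero]
  filter_upwards [hz, ae_restrict_mem hD.measurableSet, Lp.coeFn_add F₁ (κ • F₂),
    Lp.coeFn_smul κ F₂] with y h1 h2 h3 h4
  rw [h3, Pi.add_apply, h4, Pi.smul_apply, smul_eq_mul]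
  exact h1 h2

lemma inner_eq_of_adjoint_add_smul_eq_zero {H H' : Type*} [NormedAddCommGroup H]
    [InnerProductSpace ℝ H] [CompleteSpace H] [NormedAddCommGroup H'] [InnerProductSpace ℝ H']
    [CompleteSpace H'] {S T : H →L[ℝ] H'} {w w' : H'} {κ : ℝ}
    (h : ContinuousLinearMap.adjoint S w + κ • ContinuousLinearMap.adjoint T w' = 0) (u : H) :
    inner ℝ (S u) w = -(κ * inner ℝ (T u) w') := by
  have h1 : inner ℝ u (ContinuousLinearMap.adjoint S w + κ • ContinuousLinearMap.adjoint T w')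
      = 0 := by rw [h, inner_zero_right]
  rw [inner_add_right, real_inner_smul_right, ContinuousLinearMap.adjoint_inner_right,
    ContinuousLinearMap.adjoint_inner_right] at h1
  linarith

section eigen

variable {n : ℕ} {D : Set (EuclideanSpace ℝ (Fin n))} {I : Set ℝ} {a b : ℝ}
  [IsFiniteMeasure (volume.restrict D)] [IsFiniteMeasure (volume.restrict I)]

/-- Integrating an element of `H¹(D × I)` against the function `cos (κ (t - a))` along the fibres
gives an element of `H¹(D)`. -/
lemma adjoint_lift_mem_sobolevH1
    (hp : MeasurePreserving (splitLast n) (volume.restrict (productDomain D I))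
      ((volume.restrict D).prod (volume.restrict I)))
    (hD : IsOpen D) (hab : a < b) (hI : Set.Ioo a b ⊆ I) (hIm : MeasurableSet I)
    (hI' : I ⊆ Set.Icc a b)
    {q : Lp ℝ 2 (volume.restrict (productDomain D I)) ×
      Lp (EuclideanSpace ℝ (Fin (n + 1))) 2 (volume.restrict (productDomain D I))}
    (hq : q ∈ sobolevH1 (productDomain D I)) (κ : ℝ) :
    (ContinuousLinearMap.adjoint (lift hp (cosB κ a)) q.1,
      ContinuousLinearMap.adjoint (lift hp (cosB κ a)) ((headL n).compLpL 2 _ q.2)) ∈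
      sobolevH1 D := by
  intro φ hφ hc hs v
  rw [hD.interior_eq] at hs
  have hφ2 : MemLp (fun y => φ y • v) 2 (volume.restrict D) :=
    ((hφ.continuous.smul continuous_const).memLp_of_hasCompactSupport hc.smul_right).restrict D
  have hd2 : MemLp (fun x => fderiv ℝ φ x v) 2 (volume.restrict D) :=
    (((hφ.continuous_fderiv (by simp)).clm_apply continuous_const).memLp_of_hasCompactSupport
      (hc.fderiv_apply ℝ v)).restrict D
  have h1 := integral_inner_adjoint_lift hp (cosB κ a) hd2 q.1
  have h2 := integral_inner_adjoint_lift hp (cosB κ a) hφ2 ((headL n).compLpL 2 _ q.2)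
  -- With τ = 0 only derivatives along D occur, so the cosine is allowed although it does not vanish
  -- at the ends.
  have h := integral_tensor_test_of_bound hp hD hab hI hIm hI' hq hφ hc hs
    (s := cosB κ a) (S := 1) (S' := 0) (C := 0) (τ := 0) (contDiff_cosB κ a)
    (fun t => Real.abs_cos_le_one _) (by simp) le_rfl (by simp) v
  rw [integral_inner_real] at h1
  rw [integral_inner_smul_const] at h2
  refine (h1.trans (Eq.trans ?_ h)).trans (congrArg Neg.neg (Eq.trans ?_ h2.symm))
  · refine integral_congr_ae (Filter.Eventually.of_forall fun x => ?_)
    simp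
  · refine integral_congr_ae ?_
    filter_upwards [(headL n).coeFn_compLpL (p := 2) q.2] with x hx
    rw [hx, real_inner_smul_left, real_inner_smul_left, real_inner_comm]
    ring

lemma integral_sinB_test
    (hp : MeasurePreserving (splitLast n) (volume.restrict (productDomain D I))
      ((volume.restrict D).prod (volume.restrict I)))
    (hD : IsOpen D) (hab : a < b) (hI : Set.Ioo a b ⊆ I) (hIm : MeasurableSet I)
    (hI' : I ⊆ Set.Icc a b)
    {q : Lp ℝ 2 (volume.restrict (productDomain D I)) ×
      Lp (EuclideanSpace ℝ (Fin (n + 1))) 2 (volume.restrict (productDomain D I))}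
    (hq : q ∈ sobolevH1 (productDomain D I)) {κ : ℝ} (hκ : 0 ≤ κ)
    (hsin : ∃ j : ℕ, κ * (b - a) = j * Real.pi) {φ : EuclideanSpace ℝ (Fin n) → ℝ}
    (hφ : ContDiff ℝ (⊤ : ℕ∞) φ) (hc : HasCompactSupport φ) (hs : tsupport φ ⊆ D) :
    (∫ x in productDomain D I, inner ℝ (sinB κ a (splitLast n x).2 • φ (splitLast n x).1)
        ((lastL n).compLpL 2 _ q.2 x)) +
      κ * ∫ x in productDomain D I, inner ℝ (cosB κ a (splitLast n x).2 • φ (splitLast n x).1)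
        (q.1 x) = 0 := by
  have hds : ∀ t, deriv (sinB κ a) t = κ * cosB κ a t := fun t => (hasDerivAt_sinB κ a t).deriv
  have h := integral_tensor_test_of_bound hp hD hab hI hIm hI' hq hφ hc hs
    (s := sinB κ a) (S := 1) (S' := κ) (C := 2 * κ / (b - a)) (τ := 1) (contDiff_sinB κ a)
    (fun t => Real.abs_sin_le_one _)
    (fun t => by
      rw [hds, one_mul, abs_mul, abs_of_nonneg hκ]
      exact mul_le_of_le_one_right hκ (Real.abs_cos_le_one _))
    (div_nonneg (by positivity) (sub_pos.2 hab).le)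
    (fun t ht => by rw [one_mul]; exact abs_sinB_mul_le hab hκ hsin ht) 0
  rw [add_comm]
  refine eq_neg_iff_add_eq_zero.1 (Eq.trans (Eq.trans ?_ h) (congrArg Neg.neg ?_))
  · rw [← integral_const_mul]
    refine integral_congr_ae (Filter.Eventually.of_forall fun x => ?_)
    simp only [hds, map_zero, real_inner_smul_left]
    change κ * (_ * (q.1 x * φ (splitLast n x).1)) = _
    ring
  · refine integral_congr_ae ?_
    filter_upwards [(lastL n).coeFn_compLpL (p := 2) q.2] with x hx
    rw [hx, inner_zero_right, real_inner_smul_left, zero_add, mul_one]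
    change _ = _ * (lastL n (q.2 x) * φ (splitLast n x).1)
    ring

/-- This is ⟨u ⊗ sin, ∂ₜw⟩ = -κ⟨u ⊗ cos, w⟩ for merely square integrable u. Moved to D by adjoints,
it says that an L² function is zero, which is tested against smooth φ. -/
lemma inner_lift_sinB
    (hp : MeasurePreserving (splitLast n) (volume.restrict (productDomain D I))
      ((volume.restrict D).prod (volume.restrict I)))
    (hD : IsOpen D) (hab : a < b) (hI : Set.Ioo a b ⊆ I) (hIm : MeasurableSet I)
    (hI' : I ⊆ Set.Icc a b)
    {q : Lp ℝ 2 (volume.restrict (productDomain D I)) ×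
      Lp (EuclideanSpace ℝ (Fin (n + 1))) 2 (volume.restrict (productDomain D I))}
    (hq : q ∈ sobolevH1 (productDomain D I)) {κ : ℝ} (hκ : 0 ≤ κ)
    (hsin : ∃ j : ℕ, κ * (b - a) = j * Real.pi) (u : Lp ℝ 2 (volume.restrict D)) :
    inner ℝ (lift hp (sinB κ a) u) ((lastL n).compLpL 2 _ q.2) =
      -(κ * inner ℝ (lift hp (cosB κ a) u) q.1) := by
  refine inner_eq_of_adjoint_add_smul_eq_zero
    (Lp_add_smul_eq_zero_of_forall_test hD _ _ κ fun φ hφ hc hs => ?_) u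
  have hφ2 : MemLp φ 2 (volume.restrict D) :=
    (hφ.continuous.memLp_of_hasCompactSupport hc).restrict D
  refine Eq.trans ?_ (integral_sinB_test hp hD hab hI hIm hI' hq hκ hsin hφ hc hs)
  exact congrArg₂ (fun x y => x + κ * y)
    (integral_inner_adjoint_lift hp (sinB κ a) hφ2 ((lastL n).compLpL 2 _ q.2))
    (integral_inner_adjoint_lift hp (cosB κ a) hφ2 q.1)

/-- The gradient along D, paired with that of w, gives (λ - κ²)⟨u ⊗ cos, w⟩ by the equation on D
tested with the fibre average of w. The derivative along I adds κ²⟨u ⊗ cos, w⟩. -/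
lemma liftPair_mem_neumannEigenspace
    (hp : MeasurePreserving (splitLast n) (volume.restrict (productDomain D I))
      ((volume.restrict D).prod (volume.restrict I)))
    (hD : IsOpen D) (hab : a < b) (hI : Set.Ioo a b ⊆ I) (hIm : MeasurableSet I)
    (hI' : I ⊆ Set.Icc a b) {κ : ℝ} (hκ : 0 ≤ κ)
    (hsin : ∃ j : ℕ, κ * (b - a) = j * Real.pi) {lam : ℝ}
    {p : Lp ℝ 2 (volume.restrict D) × Lp (EuclideanSpace ℝ (Fin n)) 2 (volume.restrict D)}
    (hpe : p ∈ neumannEigenspace D (lam - κ ^ 2)) :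
    liftPair hp κ a p ∈ neumannEigenspace (productDomain D I) lam := by
  refine ⟨liftPair_mem_sobolevH1 hp hD κ a hpe.1, fun q hq => ?_⟩
  have h1 := hpe.2 _ (adjoint_lift_mem_sobolevH1 hp hD hab hI hIm hI' hq κ)
  simp only [ContinuousLinearMap.adjoint_inner_right] at h1
  rw [liftPair_snd, liftPair_fst, inner_sub_left, real_inner_smul_left, inner_compLpL_embHead,
    inner_compLpL_embLast, inner_lift_sinB hp hD hab hI hIm hI' hq hκ hsin, h1]
  ring

end eigen

/-! ### Counting eigenvalues -/

lemma rank_pi_fin {N : ℕ} (M : Fin N → Type) [∀ i, AddCommGroup (M i)] [∀ i, Module ℝ (M i)] :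
    Module.rank ℝ (∀ i, M i) = ∑ i, Module.rank ℝ (M i) := by
  induction N with
  | zero => simp
  | succ N ih =>
    rw [← (Fin.consLinearEquiv ℝ M).rank_eq, rank_prod', ih fun i => M i.succ, Fin.sum_univ_succ]

section counting

variable {n : ℕ} {D : Set (EuclideanSpace ℝ (Fin n))}

lemma inner_eq_zero_of_mem_neumannEigenspace {ν ν' : ℝ} (hne : ν ≠ ν')
    {p p' : Lp ℝ 2 (volume.restrict D) × Lp (EuclideanSpace ℝ (Fin n)) 2 (volume.restrict D)}
    (h : p ∈ neumannEigenspace D ν) (h' : p' ∈ neumannEigenspace D ν') :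
    inner ℝ p.1 p'.1 = 0 := by
  have h1 := h.2 p' h'.1
  have h2 := h'.2 p h.1
  rw [real_inner_comm, real_inner_comm p.1 p'.1] at h2
  have : (ν - ν') * inner ℝ p.1 p'.1 = 0 := by
    rw [sub_mul, ← h1, ← h2, sub_self]
  exact (mul_eq_zero.1 this).resolve_left (sub_ne_zero.2 hne)

/-- Testing the equation with p itself gives ‖g‖² = ν‖u‖², so u = 0 forces the gradient component g
to vanish. -/
lemma eq_zero_of_mem_neumannEigenspace {ν : ℝ}
    {p : Lp ℝ 2 (volume.restrict D) × Lp (EuclideanSpace ℝ (Fin n)) 2 (volume.restrict D)}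
    (h : p ∈ neumannEigenspace D ν) (h0 : p.1 = 0) : p = 0 := by
  have h1 := h.2 p h.1
  rw [h0, inner_zero_left, mul_zero, inner_self_eq_zero] at h1
  exact Prod.ext h0 h1

variable {I : Set ℝ} {a b : ℝ}
  [IsFiniteMeasure (volume.restrict D)] [IsFiniteMeasure (volume.restrict I)]

/-- The sum of the lifts is injective. For fixed λ, different j use different eigenvalues λ - κ_j²
of D, whose eigenspaces are orthogonal in L²(D). Pairing with the i-th lift therefore isolates the
i-th summand, and only ∫ cos² > 0 is needed, not orthogonality of the cosines. -/
lemma sum_rank_neumannEigenspace_le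
    (hp : MeasurePreserving (splitLast n) (volume.restrict (productDomain D I))
      ((volume.restrict D).prod (volume.restrict I)))
    (hD : IsOpen D) (hab : a < b) (hI : Set.Ioo a b ⊆ I) (hIm : MeasurableSet I)
    (hI' : I ⊆ Set.Icc a b) (N : ℕ) (lam : ℝ) :
    ∑ j : Fin N, Module.rank ℝ
        (neumannEigenspace D (lam - ((j : ℕ) * Real.pi / (b - a)) ^ 2)) ≤
      Module.rank ℝ (neumannEigenspace (productDomain D I) lam) := by
  have hba : 0 < b - a := sub_pos.2 hab
  set κ : Fin N → ℝ := fun j => (j : ℕ) * Real.pi / (b - a) with hκdef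
  have hκ0 : ∀ j, 0 ≤ κ j := fun j => by positivity
  have hκsin : ∀ j, ∃ m : ℕ, κ j * (b - a) = m * Real.pi := fun j =>
    ⟨j, div_mul_cancel₀ _ hba.ne'⟩
  have hκinj : ∀ i j, i ≠ j → lam - κ i ^ 2 ≠ lam - κ j ^ 2 := fun i j hij h => by
    have h1 : κ i ^ 2 = κ j ^ 2 := by linarith
    rw [sq_eq_sq₀ (hκ0 i) (hκ0 j), div_left_inj' hba.ne', mul_left_inj' Real.pi_ne_zero,
      Nat.cast_inj] at h1
    exact hij (Fin.ext h1)
  rw [← rank_pi_fin fun j => neumannEigenspace D (lam - κ j ^ 2)]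
  let Φ : (∀ j, neumannEigenspace D (lam - κ j ^ 2)) →ₗ[ℝ]
      neumannEigenspace (productDomain D I) lam :=
    LinearMap.codRestrict _
      (∑ j, (liftPair hp (κ j) a) ∘ₗ (neumannEigenspace D (lam - κ j ^ 2)).subtype ∘ₗ
        LinearMap.proj j) fun f => by
        rw [LinearMap.sum_apply]
        exact Submodule.sum_mem _ fun j _ => liftPair_mem_neumannEigenspace hp hD hab hI hIm hI'
          (hκ0 j) (hκsin j) (f j).2
  refine Φ.rank_le_of_injective ((injective_iff_map_eq_zero Φ).2 fun f hf => ?_)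
  have hsum : ∑ j, lift hp (cosB (κ j) a) (f j).1.1 = 0 := by
    have h1 : (Φ f).1.1 = 0 := by rw [hf]; rfl
    have h2 : (Φ f).1 = ∑ j, liftPair hp (κ j) a (f j).1 := by
      change (∑ j, (liftPair hp (κ j) a) ∘ₗ (neumannEigenspace D (lam - κ j ^ 2)).subtype ∘ₗ
        LinearMap.proj j) f = _
      rw [LinearMap.sum_apply]
      rfl
    rw [h2, Prod.fst_sum] at h1
    exact h1
  funext i
  refine Subtype.ext (eq_zero_of_mem_neumannEigenspace (f i).2 ?_)
  have h1 : inner ℝ (lift hp (cosB (κ i) a) (f i).1.1)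
      (∑ j, lift hp (cosB (κ j) a) (f j).1.1) = 0 := by rw [hsum, inner_zero_right]
  rw [inner_sum, Finset.sum_eq_single i (fun j _ hj => by
    rw [inner_lift, inner_eq_zero_of_mem_neumannEigenspace (hκinj i j hj.symm) (f i).2 (f j).2,
      zero_mul]) (by simp), inner_lift] at h1
  have h2 : 0 < ∫ t in I, cosB (κ i) a t * cosB (κ i) a t := by
    refine (integral_cosB_sq_pos hab).trans_le
      (setIntegral_mono_set ?_ (Filter.Eventually.of_forall fun t => mul_self_nonneg _)
        hI.eventuallyLE)
    exact ((cosB (κ i) a * cosB (κ i) a).integrable (volume.restrict I))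
  exact inner_self_eq_zero.1 ((mul_eq_zero.1 h1).resolve_right h2.ne')

/-- Separation of variables: the eigenvalues of `D` shifted by `(jπ/L)²` are eigenvalues of
`D × I`. -/
lemma sum_neumannCounting_le
    (hp : MeasurePreserving (splitLast n) (volume.restrict (productDomain D I))
      ((volume.restrict D).prod (volume.restrict I)))
    (hD : IsOpen D) (hab : a < b) (hI : Set.Ioo a b ⊆ I) (hIm : MeasurableSet I)
    (hI' : I ⊆ Set.Icc a b) (N : ℕ) (μ : ℝ)
    (hN : ∀ j < N, ((j : ℕ) * Real.pi / (b - a)) ^ 2 ≤ μ ^ 2) :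
    ∑ j ∈ Finset.range N, neumannCounting D √(μ ^ 2 - ((j : ℕ) * Real.pi / (b - a)) ^ 2) ≤
      neumannCounting (productDomain D I) μ := by
  set κ : ℕ → ℝ := fun j => (j : ℕ) * Real.pi / (b - a) with hκ
  -- Reindexing by the shifted eigenvalue puts all N sums over the same set, so the ranks can be
  -- compared eigenvalue by eigenvalue.
  have hshift : ∀ j < N, neumannCounting D √(μ ^ 2 - κ j ^ 2) = ∑' ν : {ν : ℝ // ν ≤ μ ^ 2},
      ((Module.rank ℝ (neumannEigenspace D (ν - κ j ^ 2))).toENat : ℝ≥0∞) := fun j hj => by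
    unfold neumannCounting
    rw [Real.sq_sqrt (sub_nonneg.2 (hN j hj))]
    let e : {ν : ℝ // ν ≤ μ ^ 2} ≃ {ν : ℝ // ν ≤ μ ^ 2 - κ j ^ 2} :=
      { toFun := fun ν => ⟨ν - κ j ^ 2, by linarith [ν.2]⟩
        invFun := fun ν => ⟨ν + κ j ^ 2, by linarith [ν.2]⟩
        left_inv := fun ν => Subtype.ext (sub_add_cancel _ _)
        right_inv := fun ν => Subtype.ext (add_sub_cancel_right _ _) }
    exact (e.tsum_eq fun ν : {ν : ℝ // ν ≤ μ ^ 2 - κ j ^ 2} =>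
      ((Module.rank ℝ (neumannEigenspace D ν)).toENat : ℝ≥0∞)).symm
  rw [Finset.sum_congr rfl fun j hj => hshift j (Finset.mem_range.1 hj),
    ← Summable.tsum_finsetSum fun _ _ => ENNReal.summable]
  refine ENNReal.tsum_le_tsum fun ν => ?_
  have h := Cardinal.toENat.monotone'
    (sum_rank_neumannEigenspace_le hp hD hab hI hIm hI' N (ν : ℝ))
  change Cardinal.toENat _ ≤ Cardinal.toENat _ at h
  rw [map_sum, Fin.sum_univ_eq_sum_range fun j =>
    Cardinal.toENat (Module.rank ℝ (neumannEigenspace D ((ν : ℝ) - κ j ^ 2)))] at h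
  have h2 := ENat.toENNReal_mono h
  have h3 := map_sum ENat.toENNRealRingHom (fun j =>
    Cardinal.toENat (Module.rank ℝ (neumannEigenspace D ((ν : ℝ) - κ j ^ 2)))) (Finset.range N)
  exact (h3.symm.le).trans h2

end counting

/-- The Weyl-type lower bound obtained by separation of variables from the Pólya bound on `D`. -/
lemma neumannCounting_productDomain_ge {n : ℕ} {D : Set (EuclideanSpace ℝ (Fin n))}
    (hD : IsOpen D) (hDb : Bornology.IsBounded D) {L a : ℝ} (hL : 0 < L) {I : Set ℝ}
    (hI : Set.Ioo a (a + L) ⊆ I) (hI' : I ⊆ Set.Icc a (a + L)) (hIm : MeasurableSet I)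
    (hP : NeumannPolya D) {μ : ℝ} (hμ : 0 < μ) :
    ENNReal.ofReal (unitBallVol n / (2 * Real.pi) ^ n * volume.real D * μ ^ n *
      ∑ j ∈ Finset.range (⌊L * μ / Real.pi⌋₊ + 1), ballProfile n (j / (L * μ / Real.pi))) ≤
      neumannCounting (productDomain D I) μ := by
  have : IsFiniteMeasure (volume.restrict D) :=
    isFiniteMeasure_restrict.2 hDb.measure_lt_top.ne
  have : IsFiniteMeasure (volume.restrict I) :=
    isFiniteMeasure_restrict.2 (((measure_mono hI').trans_lt measure_Icc_lt_top).ne)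
  have hp := measurePreserving_splitLast_productDomain (n := n) hD.measurableSet hIm
  have hM : 0 < L * μ / Real.pi := by positivity
  have hκ : ∀ j : ℕ, (j * Real.pi / (a + L - a)) ^ 2 = μ ^ 2 * (j / (L * μ / Real.pi)) ^ 2 :=
    fun j => by rw [add_sub_cancel_left]; field_simp
  have hj1 : ∀ j < ⌊L * μ / Real.pi⌋₊ + 1, (j / (L * μ / Real.pi)) ^ 2 ≤ 1 := fun j hj => by
    have h1 : (j : ℝ) ≤ L * μ / Real.pi :=
      (Nat.cast_le.2 (Nat.lt_succ_iff.1 hj)).trans (Nat.floor_le hM.le)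
    exact pow_le_one₀ (by positivity) ((div_le_one hM).2 h1)
  refine le_trans ?_ (sum_neumannCounting_le hp hD (by linarith) hI hIm hI'
    (⌊L * μ / Real.pi⌋₊ + 1) μ fun j hj => ?_)
  · have hK : 0 ≤ unitBallVol n / (2 * Real.pi) ^ n * volume.real D := by
      have : 0 ≤ unitBallVol n := measureReal_nonneg
      positivity
    rw [Finset.mul_sum, ENNReal.ofReal_sum_of_nonneg fun j _ =>
      mul_nonneg (by positivity) (ballProfile_nonneg _ _)]
    refine Finset.sum_le_sum fun j hj => ?_
    refine le_trans (le_of_eq ?_) (hP _ (Real.sqrt_nonneg _))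
    rw [mul_assoc]
    congr 2
    rw [hκ, ballProfile, ← mul_pow]
    congr 1
    rw [show μ ^ 2 - μ ^ 2 * (j / (L * μ / Real.pi)) ^ 2
      = μ ^ 2 * (1 - (j / (L * μ / Real.pi)) ^ 2) by ring, Real.sqrt_mul (sq_nonneg μ),
      Real.sqrt_sq hμ.le]
  · rw [hκ]
    exact mul_le_of_le_one_right (sq_nonneg μ) (hj1 j hj)

/-! ### Constants and assembly -/

lemma unitBallVol_two : unitBallVol 2 = Real.pi := by
  rw [unitBallVol, measureReal_def, EuclideanSpace.volume_ball_fin_two]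
  simp [Real.pi_nonneg]

lemma unitBallVol_three : unitBallVol 3 = 4 * Real.pi / 3 := by
  rw [unitBallVol, measureReal_def, EuclideanSpace.volume_ball_fin_three, ENNReal.ofReal_one,
    one_pow, one_mul, ENNReal.toReal_ofReal (by positivity)]
  ring

lemma measurableSet_of_Ioo_subset_subset_Icc {a b : ℝ} {I : Set ℝ} (hI : Set.Ioo a b ⊆ I)
    (hI' : I ⊆ Set.Icc a b) : MeasurableSet I := by
  have h : I = Set.Ioo a b ∪ (I ∩ {a, b}) := by
    ext t
    constructor
    · intro ht
      rcases eq_or_ne t a with h | h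
      · exact Or.inr ⟨ht, Or.inl h⟩
      rcases eq_or_ne t b with h' | h'
      · exact Or.inr ⟨ht, Or.inr h'⟩
      exact Or.inl ⟨lt_of_le_of_ne (hI' ht).1 h.symm, lt_of_le_of_ne (hI' ht).2 h'⟩
    · rintro (ht | ht)
      exacts [hI ht, ht.1]
  rw [h]
  exact measurableSet_Ioo.union ((Set.toFinite {a, b}).inter_of_right I).measurableSet

lemma volume_real_of_Ioo_subset_subset_Icc {a L : ℝ} (hL : 0 < L) {I : Set ℝ}
    (hI : Set.Ioo a (a + L) ⊆ I) (hI' : I ⊆ Set.Icc a (a + L)) : volume.real I = L := by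
  have h1 := measure_mono (μ := volume) hI
  have h2 := measure_mono (μ := volume) hI'
  rw [Real.volume_Ioo, add_sub_cancel_left] at h1
  rw [Real.volume_Icc, add_sub_cancel_left] at h2
  rw [measureReal_def, le_antisymm h2 h1, ENNReal.toReal_ofReal hL.le]

/-- The Weyl term of `D × I` in terms of that of `D`. -/
lemma weyl_term_eq {n : ℕ} (hn : n ≠ 0) {L : ℝ} (V μ : ℝ) :
    unitBallVol (n + 1) / (2 * Real.pi) ^ (n + 1) * (V * L) * μ ^ (n + 1) =
      unitBallVol n / (2 * Real.pi) ^ n * V * μ ^ n *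
        (ballProfileIntegral n * (L * μ / Real.pi)) := by
  rw [unitBallVol_succ hn, pow_succ, pow_succ]
  have := Real.pi_pos
  field_simp

theorem theorem3p4 (d n : ℕ) (hd : 3 ≤ d) (hdn : d = n + 1)
    (D : Set (EuclideanSpace ℝ (Fin n)))
    (hDopen : IsOpen D) (hDconn : IsConnected D) (hDbdd : Bornology.IsBounded D)
    (L a : ℝ) (hL : 0 < L) (I : Set ℝ)
    (hI : Set.Ioo a (a + L) ⊆ I) (hI' : I ⊆ Set.Icc a (a + L))
    (hPolya : NeumannPolya D) :
    (d = 3 → ∀ μ : ℝ, 0 ≤ μ →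
      (1 / 3 ≤ L * μ / Real.pi →
        ENNReal.ofReal
          (unitBallVol 3 / (2 * Real.pi) ^ 3 * volume.real (productDomain D I) * μ ^ 3 +
            volume.real (productDomain D I) / (8 * L ^ 2) * (L * μ / Real.pi - 1 / 3) * μ) ≤
          neumannCounting (productDomain D I) μ) ∧
      (L * μ / Real.pi ≤ 3 / 2 →
        ENNReal.ofReal
          (unitBallVol 3 / (2 * Real.pi) ^ 3 * volume.real (productDomain D I) * μ ^ 3 +
            volume.real (productDomain D I) / (6 * Real.pi * L) * (3 / 2 - L * μ / Real.pi) * μ ^ 2) ≤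
          neumannCounting (productDomain D I) μ)) ∧
    (4 ≤ d → ∀ μ : ℝ, 0 ≤ μ →
      (L * μ / Real.pi ≤
          2 * Real.Gamma (((d : ℝ) + 2) / 2) / (√Real.pi * Real.Gamma (((d : ℝ) + 1) / 2)) →
        ENNReal.ofReal
          (unitBallVol d / (2 * Real.pi) ^ d * volume.real (productDomain D I) * μ ^ d +
            unitBallVol d * volume.real (productDomain D I) / (2 * (2 * Real.pi) ^ (d - 1) * L) *
              (2 * Real.Gamma (((d : ℝ) + 2) / 2) /
                (√Real.pi * Real.Gamma (((d : ℝ) + 1) / 2)) - L * μ / Real.pi) *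
              μ ^ (d - 1)) ≤
          neumannCounting (productDomain D I) μ) ∧
      (Real.pi * √((d : ℝ) - 2) / L ≤ μ →
        ENNReal.ofReal
          (unitBallVol d / (2 * Real.pi) ^ d * volume.real (productDomain D I) * μ ^ d +
            ((d : ℝ) - 1) * unitBallVol (d - 1) * volume.real (productDomain D I) /
                (4 * (2 * Real.pi) ^ (d - 1) * L) *
              (ratioT d L μ ^ 2 * (1 - constA1 d * ratioT d L μ ^ 2)) * μ ^ (d - 1)) ≤
          neumannCounting (productDomain D I) μ) ∧
      (11 ≤ d → Real.pi * √((d : ℝ) - 2) / L ≤ μ →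
        ENNReal.ofReal
          (unitBallVol d / (2 * Real.pi) ^ d * volume.real (productDomain D I) * μ ^ d +
            ((d : ℝ) - 1) * unitBallVol (d - 1) * volume.real (productDomain D I) /
                (4 * (2 * Real.pi) ^ (d - 1) * L) *
              (ratioT d L μ ^ 2 * (1 - constA1 d * ratioT d L μ ^ 2)) * μ ^ (d - 1) +
            unitBallVol (d - 1) * volume.real (productDomain D I) /
                (2 * (2 * Real.pi) ^ (d - 1) * L) *
              (1 - (Real.pi / (L * μ) *
                ((⌊L * μ / (Real.pi * √((d : ℝ) - 2))⌋ : ℝ) + 1)) ^ 2) ^ (((d : ℝ) - 1) / 2) *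
              μ ^ (d - 1)) ≤
          neumannCounting (productDomain D I) μ)) ∧
    NeumannPolya (productDomain D I) := by
  subst hdn
  have hn : n ≠ 0 := by omega
  have hIm := measurableSet_of_Ioo_subset_subset_Icc hI hI'
  have hπ := Real.pi_pos
  have hvol : volume.real (productDomain D I) = volume.real D * L := by
    rw [volume_real_productDomain hDopen.measurableSet hIm,
      volume_real_of_Ioo_subset_subset_Icc hL hI hI']
  have hV : 0 ≤ volume.real D := measureReal_nonneg
  have hω : 0 ≤ unitBallVol n := measureReal_nonneg
  -- Reduces each claim to a lower bound s for the Riemann sum, together with an identity matching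
  -- the constants.
  have main : ∀ μ, 0 < μ → ∀ X s : ℝ,
      X = unitBallVol n / (2 * Real.pi) ^ n * volume.real D * μ ^ n * s →
      s ≤ ∑ j ∈ Finset.range (⌊L * μ / Real.pi⌋₊ + 1), ballProfile n (j / (L * μ / Real.pi)) →
      ENNReal.ofReal X ≤ neumannCounting (productDomain D I) μ := by
    intro μ hμ X s hX hs
    refine le_trans (ENNReal.ofReal_le_ofReal ?_)
      (neumannCounting_productDomain_ge hDopen hDbdd hL hI hI' hIm hPolya hμ)
    rw [hX]
    exact mul_le_mul_of_nonneg_left hs (by positivity)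
  rw [hvol]
  refine ⟨fun h3 μ hμ => ?_, fun h4 μ hμ => ?_, fun μ hμ => ?_⟩
  · obtain rfl : n = 2 := by omega
    rw [unitBallVol_three]
    rw [unitBallVol_two] at main
    refine ⟨fun h => ?_, fun h => ?_⟩
    · have hM : 0 < L * μ / Real.pi := by linarith
      have hμ0 : 0 < μ := by
        refine lt_of_le_of_ne hμ fun h0 => ?_
        rw [← h0] at hM
        simp at hM
      refine main μ hμ0 _ _ ?_ (sum_ballProfile_two_ge hM)
      field_simp
      ring
    · rcases hμ.eq_or_lt with rfl | hμ0
      · simp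
      -- Here s = 1, the term j = 0; the Weyl term plus the stated correction equals exactly the
      -- prefactor.
      refine main μ hμ0 _ 1 ?_ (one_le_sum_ballProfile _ _)
      field_simp
      ring
  · have hn3 : 3 ≤ n := by omega
    have hn3' : (3 : ℝ) ≤ n := by exact_mod_cast hn3
    have hsub : ((n + 1 : ℕ) : ℝ) - 2 = n - 1 := by push_cast; ring
    have hsub1 : ((n + 1 : ℕ) : ℝ) - 1 = n := by push_cast; ring
    have hc : 0 < √((n : ℝ) - 1) := Real.sqrt_pos.2 (by linarith)
    rw [hsub, hsub1, Nat.add_sub_cancel, weyl_term_eq hn]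
    have hpos : Real.pi * √((n : ℝ) - 1) / L ≤ μ → 0 < μ := fun h => lt_of_lt_of_le (by positivity) h
    have hMge : Real.pi * √((n : ℝ) - 1) / L ≤ μ → √((n : ℝ) - 1) ≤ L * μ / Real.pi := fun h => by
      rw [div_le_iff₀ hL] at h
      rw [le_div_iff₀ hπ]
      linarith
    have hfloor : L * μ / (Real.pi * √((n : ℝ) - 1)) = L * μ / Real.pi / √((n : ℝ) - 1) := by
      rw [div_div]
    have hT : ratioT (n + 1) L μ =
        ((⌊L * μ / Real.pi / √((n : ℝ) - 1)⌋ : ℝ) - 1) / (L * μ / Real.pi) := by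
      rw [ratioT, hsub, hfloor]
    have hTb : Real.pi * √((n : ℝ) - 1) / L ≤ μ →
        0 ≤ ratioT (n + 1) L μ ∧ ratioT (n + 1) L μ ≤ 1 := fun h => by
      have hM := hMge h
      have hM0 : 0 < L * μ / Real.pi := hc.trans_le hM
      rw [hT]
      have h1 : (1 : ℝ) ≤ ⌊L * μ / Real.pi / √((n : ℝ) - 1)⌋ := by
        exact_mod_cast Int.le_floor.2 (by simpa using (one_le_div hc).2 hM)
      have h2 : L * μ / Real.pi / √((n : ℝ) - 1) ≤ L * μ / Real.pi :=
        div_le_self hM0.le (Real.one_le_sqrt.2 (by linarith))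
      refine ⟨div_nonneg (by linarith) hM0.le, (div_le_one hM0).2 ?_⟩
      linarith [Int.floor_le (L * μ / Real.pi / √((n : ℝ) - 1))]
    refine ⟨fun h => ?_, fun h => ?_, fun h11 h => ?_⟩
    · rcases hμ.eq_or_lt with rfl | hμ0
      · simp [hn]
      refine main μ hμ0 _ 1 ?_ (one_le_sum_ballProfile _ _)
      have hB := ballProfileIntegral_mul_Gamma hn
      generalize 2 * Real.Gamma (((n + 1 : ℕ) + 2) / 2) /
        (√Real.pi * Real.Gamma (((n + 1 : ℕ) + 1) / 2)) = R at *
      rw [unitBallVol_succ hn, ← hB]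
      field_simp
      ring
    · have hμ0 := hpos h
      refine main μ hμ0 _ (ballProfileIntegral n * (L * μ / Real.pi) +
        (n : ℝ) / 4 * (ratioT (n + 1) L μ ^ 2 *
          (1 - constA1 (n + 1) * ratioT (n + 1) L μ ^ 2))) ?_
        (le_trans ?_ (sum_ballProfile_ge_improved hn3 (hMge h)))
      · field_simp
      · have h1 := one_sub_ballProfile_ge hn3 (hTb h).1 (hTb h).2
        rw [← hT]
        linarith [ballProfile_nonneg n
          (((⌊L * μ / Real.pi / √((n : ℝ) - 1)⌋ : ℝ) + 1) / (L * μ / Real.pi))]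
    · have hμ0 := hpos h
      have hM := hMge h
      have hM0 : 0 < L * μ / Real.pi := hc.trans_le hM
      have hn10 : (10 : ℝ) ≤ n := by exact_mod_cast (by omega : 10 ≤ n)
      -- This gives p + 1 ≤ M/3 + 1 ≤ M for the floor p. The base of the real power in (d) is then
      -- nonnegative, so the power agrees with the profile.
      have hc3 : 3 ≤ √((n : ℝ) - 1) := Real.le_sqrt_of_sq_le (by linarith)
      have harg : Real.pi / (L * μ) * ((⌊L * μ / (Real.pi * √((n : ℝ) - 1))⌋ : ℝ) + 1) =
          ((⌊L * μ / Real.pi / √((n : ℝ) - 1)⌋ : ℝ) + 1) / (L * μ / Real.pi) := by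
        rw [hfloor]; field_simp
      have hp0 : (0 : ℝ) ≤ ⌊L * μ / Real.pi / √((n : ℝ) - 1)⌋ := by
        exact_mod_cast Int.floor_nonneg.2 (by positivity)
      have hp1 : (⌊L * μ / Real.pi / √((n : ℝ) - 1)⌋ : ℝ) ≤ L * μ / Real.pi / 3 :=
        (Int.floor_le _).trans (by gcongr)
      have hx1 : ((⌊L * μ / Real.pi / √((n : ℝ) - 1)⌋ : ℝ) + 1) / (L * μ / Real.pi) ≤ 1 :=
        (div_le_one hM0).2 (by linarith)
      rw [harg, ← ballProfile_eq_rpow n (sub_nonneg.2 (pow_le_one₀ (by positivity) hx1))]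
      refine main μ hμ0 _ (ballProfileIntegral n * (L * μ / Real.pi) +
        (n : ℝ) / 4 * (ratioT (n + 1) L μ ^ 2 *
          (1 - constA1 (n + 1) * ratioT (n + 1) L μ ^ 2)) +
        ballProfile n (((⌊L * μ / Real.pi / √((n : ℝ) - 1)⌋ : ℝ) + 1) / (L * μ / Real.pi)) / 2) ?_
        (le_trans ?_ (sum_ballProfile_ge_improved hn3 hM))
      · generalize ballProfile n (((⌊L * μ / Real.pi / √((n : ℝ) - 1)⌋ : ℝ) + 1) /
          (L * μ / Real.pi)) = P
        field_simp
      · have h1 := one_sub_ballProfile_ge hn3 (hTb h).1 (hTb h).2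
        rw [← hT]
        linarith
  · rw [hvol, weyl_term_eq hn]
    rcases hμ.eq_or_lt with rfl | hμ0
    · simp [hn]
    exact main μ hμ0 _ _ rfl (sum_ballProfile_ge_integral hn (by positivity))
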